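/- Let $\mathbb{F}$ be $\mathbb{R}$ or $\mathbb{C}$ and let $n\ge 3$. Let $Q_{2n}$ be the nilpotent Lie algebra over $\mathbb{F}$ with basis $X_1,\dots,X_{2n}$ and brackets $$[X_1,X_k]=X_{k+1}\ (2\le k\le 2n-2),\qquad [X_k,X_{2n+1-k}]=(-1)^kX_{2n}\ (2\le k\le n),$$ and let $\mathfrak{r}_{2n+2}$ be the Lie algebra over $\mathbb{F}$ with basis $X_1,\dots,X_{2n},Y_1,Y_2$ and brackets $$[X_1,X_k]=X_{k+1}\ (2\le k\le 2n-2),\qquad [X_k,X_{2n+1-k}]=(-1)^kX_{2n}\ (2\le k\le n),$$ $$[Y_1,X_k]=kX_k\ (1\le k\le 2n-1),\qquad [Y_1,X_{2n}]=(2n+1)X_{2n},$$ $$[Y_2,X_k]=X_k\ (2\le k\le 2n-1),\qquad [Y_2,X_{2n}]=2X_{2n},$$ where in both cases all brackets of basis vectors that do not follow from the listed ones by antisymmetry are zero. The nilradical of a finite-dimensional Lie algebra is its largest nilpotent ideal. Then $\mathfrak{r}_{2n+2}$ is a solvable Lie algebra of dimension $2n+2$ whose nilradical is isomorphic to $Q_{2n}$,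 and every solvable Lie algebra over $\mathbb{F}$ of dimension $2n+2$ whose nilradical is isomorphic to $Q_{2n}$ is isomorphic to $\mathfrak{r}_{2n+2}$. -/

import Mathlib

/-- The nilradical of a Lie algebra `L`: the largest nilpotent ideal, that is, the sum of all
ideals that are nilpotent as Lie algebras. (`LieAlgebra.maxNilpotentIdeal` is a different ideal: it
asks the ideal to be nilpotent as an `L`-module.) -/
def nilradicalIdeal (K L : Type*) [CommRing K] [LieRing L] [LieAlgebra K L] : LieIdeal K L :=
  sSup {I : LieIdeal K L | LieRing.IsNilpotent I}

/-- Coordinate vectors `(x₁, …, x_{2n})` with respect to a basis `X₁, …, X_{2n}`. -/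
abbrev QCoord (K : Type*) (n : ℕ) : Type _ := (Finset.Icc 1 (2 * n)) → K

section Bracket

variable {K : Type*} [Field K] {n : ℕ}

/-- The `k`-th coordinate `x_k`, with `x_k = 0` unless `1 ≤ k ≤ 2n`. -/
def QCoord.coord (x : QCoord K n) (k : ℕ) : K :=
  if h : k ∈ Finset.Icc 1 (2 * n) then x ⟨k, h⟩ else 0

/-- The bracket of `Q_{2n}` in coordinates, i.e. the bilinear alternating extension of
`[X₁, X_k] = X_{k+1}` for `2 ≤ k ≤ 2n-2` and `[X_k, X_{2n+1-k}] = (-1)^k X_{2n}` for `2 ≤ k ≤ n`,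
all other brackets of basis vectors `X_i, X_j` with `i < j` being zero. -/
def qBracket (x y : QCoord K n) : QCoord K n := fun k =>
  if (k : ℕ) = 2 * n then
    ∑ i ∈ Finset.Icc 2 n, (-1) ^ i * (x.coord i * y.coord (2 * n + 1 - i) - y.coord i * x.coord (2 * n + 1 - i))
  else if 3 ≤ (k : ℕ) then x.coord 1 * y.coord (k - 1) - y.coord 1 * x.coord (k - 1)
  else 0

/-- Eigenvalues of `ad Y₁`: `k` on `X_k` for `1 ≤ k ≤ 2n-1`, and `2n+1` on `X_{2n}`. -/
def weightOne (K : Type*) [Field K] (n k : ℕ) : K :=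
  if k = 2 * n then 2 * (n : K) + 1 else (k : K)

/-- Eigenvalues of `ad Y₂`: `0` on `X₁`, `1` on `X_k` for `2 ≤ k ≤ 2n-1`, and `2` on `X_{2n}`. -/
def weightTwo (K : Type*) [Field K] (n k : ℕ) : K :=
  if k = 2 * n then 2 else if k = 1 then 0 else 1

/-- The diagonal endomorphism by which `a₁ Y₁ + a₂ Y₂` acts on `Q_{2n}`. -/
def torusAct (a : Fin 2 → K) (x : QCoord K n) : QCoord K n := fun k =>
  (a 0 * weightOne K n k + a 1 * weightTwo K n k) * x k

theorem QCoord.coord_add (x y : QCoord K n) (k : ℕ) : (x + y).coord k = x.coord k + y.coord k := by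
  unfold QCoord.coord; split_ifs <;> simp

theorem QCoord.coord_smul (t : K) (x : QCoord K n) (k : ℕ) : (t • x).coord k = t * x.coord k := by
  unfold QCoord.coord; split_ifs <;> simp

theorem QCoord.coord_coe (x : QCoord K n) (k : Finset.Icc 1 (2 * n)) : x.coord k = x k := by
  unfold QCoord.coord; simp

theorem QCoord.ext_at {x y : QCoord K n}
    (h : ∀ k : ℕ, 1 ≤ k → k ≤ 2 * n → x.coord k = y.coord k) : x = y := by
  funext k
  have := h k (Finset.mem_Icc.1 k.2).1 (Finset.mem_Icc.1 k.2).2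
  rwa [QCoord.coord_coe, QCoord.coord_coe] at this

/-- The `X_{2n}`-coordinate of the bracket as a sum over `2 ≤ i ≤ 2n-1`. -/
theorem sum_Icc_fold (n : ℕ) (f g : ℕ → K) :
    ∑ i ∈ Finset.Icc 2 n, (-1) ^ i * (f i * g (2 * n + 1 - i) - g i * f (2 * n + 1 - i)) =
      ∑ i ∈ Finset.Icc 2 (2 * n - 1), (-1) ^ i * (f i * g (2 * n + 1 - i)) := by
  have hu : Finset.Icc 2 (2 * n - 1) = Finset.Icc 2 n ∪ Finset.Icc (n + 1) (2 * n - 1) := by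
    ext i; simp only [Finset.mem_union, Finset.mem_Icc]; omega
  have hd : Disjoint (Finset.Icc 2 n) (Finset.Icc (n + 1) (2 * n - 1)) := by
    rw [Finset.disjoint_left]; intro i; simp only [Finset.mem_Icc]; omega
  rw [hu, Finset.sum_union hd]
  simp only [mul_sub]
  rw [Finset.sum_sub_distrib, sub_eq_add_neg, ← Finset.sum_neg_distrib]
  congr 1
  refine Finset.sum_nbij' (fun i => 2 * n + 1 - i) (fun i => 2 * n + 1 - i) ?_ ?_ ?_ ?_ ?_
  · intro i; simp only [Finset.mem_Icc]; omega
  · intro i; simp only [Finset.mem_Icc]; omega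
  · intro i; simp only [Finset.mem_Icc]; omega
  · intro i; simp only [Finset.mem_Icc]; omega
  · intro i hi
    simp only [Finset.mem_Icc] at hi
    have h1 : 2 * n + 1 - (2 * n + 1 - i) = i := by omega
    have h2 : (-1 : K) ^ (2 * n + 1 - i) = -(-1) ^ i := by
      rcases Nat.even_or_odd i with h | h
      · have : Odd (2 * n + 1 - i) := by
          obtain ⟨r, hr⟩ := h; exact ⟨n - r, by omega⟩
        rw [h.neg_one_pow, this.neg_one_pow]
      · have : Even (2 * n + 1 - i) := by
          obtain ⟨r, hr⟩ := h; exact ⟨n - r, by omega⟩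
        rw [h.neg_one_pow, this.neg_one_pow]; simp
    rw [h1, h2]; ring

theorem qBracket_at_last (x y : QCoord K n) (hn : 1 ≤ n) : (qBracket x y).coord (2 * n) =
    ∑ i ∈ Finset.Icc 2 (2 * n - 1), (-1) ^ i * (x.coord i * y.coord (2 * n + 1 - i)) := by
  have h : 2 * n ∈ Finset.Icc 1 (2 * n) := by simp only [Finset.mem_Icc]; omega
  rw [QCoord.coord, dif_pos h, qBracket, if_pos rfl, sum_Icc_fold]

theorem qBracket_at_mid (x y : QCoord K n) (k : ℕ) (h3 : 3 ≤ k) (hk : k < 2 * n) :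
    (qBracket x y).coord k = x.coord 1 * y.coord (k - 1) - y.coord 1 * x.coord (k - 1) := by
  have h : k ∈ Finset.Icc 1 (2 * n) := by simp only [Finset.mem_Icc]; omega
  rw [QCoord.coord, dif_pos h, qBracket, if_neg (by simpa using hk.ne), if_pos (by simpa using h3)]

theorem qBracket_at_low (x y : QCoord K n) (k : ℕ) (h3 : k < 3) (hk : k < 2 * n) :
    (qBracket x y).coord k = 0 := by
  unfold QCoord.coord
  split_ifs with h
  · rw [qBracket, if_neg (by simpa using hk.ne), if_neg (by simpa using h3)]
  · rfl

theorem torusAct_at (a : Fin 2 → K) (x : QCoord K n) (k : ℕ) :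
    (torusAct a x).coord k = (a 0 * weightOne K n k + a 1 * weightTwo K n k) * x.coord k := by
  unfold QCoord.coord; split_ifs <;> simp [torusAct]

theorem qBracket_self (x : QCoord K n) : qBracket x x = 0 := by
  funext k; simp only [qBracket]; split_ifs <;> simp

theorem qBracket_add_left (x y z : QCoord K n) :
    qBracket (x + y) z = qBracket x z + qBracket y z := by
  funext k; simp only [qBracket, QCoord.coord_add, Pi.add_apply]
  split_ifs
  · rw [← Finset.sum_add_distrib]; exact Finset.sum_congr rfl fun i _ => by ring
  · ring
  · ring

theorem qBracket_swap (x y : QCoord K n) : qBracket x y = -qBracket y x := by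
  funext k; simp only [qBracket, Pi.neg_apply]
  split_ifs
  · rw [← Finset.sum_neg_distrib]; exact Finset.sum_congr rfl fun i _ => by ring
  · ring
  · ring

theorem qBracket_add_right (x y z : QCoord K n) :
    qBracket x (y + z) = qBracket x y + qBracket x z := by
  rw [qBracket_swap, qBracket_add_left, qBracket_swap y, qBracket_swap z]; abel

theorem qBracket_smul_right (t : K) (x y : QCoord K n) :
    qBracket x (t • y) = t • qBracket x y := by
  funext k; simp only [qBracket, QCoord.coord_smul, Pi.smul_apply, smul_eq_mul]
  split_ifs
  · rw [Finset.mul_sum]; exact Finset.sum_congr rfl fun i _ => by ring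
  · ring
  · ring

/-- The `X_{2n}`-coordinate of a double bracket. -/
theorem qBracket_qBracket_at_last (x y z : QCoord K n) (hn : 2 ≤ n) :
    (qBracket x (qBracket y z)).coord (2 * n) =
      y.coord 1 * ∑ i ∈ Finset.Icc 2 (2 * n - 2), (-1) ^ i * (x.coord i * z.coord (2 * n - i)) -
      z.coord 1 * ∑ i ∈ Finset.Icc 2 (2 * n - 2), (-1) ^ i * (x.coord i * y.coord (2 * n - i)) := by
  rw [qBracket_at_last _ _ (by omega)]
  have hu : Finset.Icc 2 (2 * n - 1) = insert (2 * n - 1) (Finset.Icc 2 (2 * n - 2)) := by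
    ext i; simp only [Finset.mem_insert, Finset.mem_Icc]; omega
  rw [hu, Finset.sum_insert (by simp only [Finset.mem_Icc]; omega),
    show 2 * n + 1 - (2 * n - 1) = 2 by omega, qBracket_at_low _ _ _ (by omega) (by omega),
    Finset.mul_sum, Finset.mul_sum, ← Finset.sum_sub_distrib]
  simp only [mul_zero, zero_add]
  refine Finset.sum_congr rfl fun i hi => ?_
  simp only [Finset.mem_Icc] at hi
  rw [qBracket_at_mid _ _ _ (by omega) (by omega), show 2 * n + 1 - i - 1 = 2 * n - i by omega]
  ring

theorem sum_Icc_symm (n : ℕ) (f g : ℕ → K) :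
    ∑ i ∈ Finset.Icc 2 (2 * n - 2), (-1) ^ i * (f i * g (2 * n - i)) =
      ∑ i ∈ Finset.Icc 2 (2 * n - 2), (-1) ^ i * (g i * f (2 * n - i)) := by
  refine Finset.sum_nbij' (fun i => 2 * n - i) (fun i => 2 * n - i) ?_ ?_ ?_ ?_ ?_
  · intro i; simp only [Finset.mem_Icc]; omega
  · intro i; simp only [Finset.mem_Icc]; omega
  · intro i; simp only [Finset.mem_Icc]; omega
  · intro i; simp only [Finset.mem_Icc]; omega
  · intro i hi
    simp only [Finset.mem_Icc] at hi
    have h1 : 2 * n - (2 * n - i) = i := by omega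
    have h2 : (-1 : K) ^ (2 * n - i) = (-1) ^ i := by
      rcases Nat.even_or_odd i with h | h
      · have : Even (2 * n - i) := by
          obtain ⟨r, hr⟩ := h; exact ⟨n - r, by omega⟩
        rw [h.neg_one_pow, this.neg_one_pow]
      · have : Odd (2 * n - i) := by
          obtain ⟨r, hr⟩ := h; exact ⟨n - r - 1, by omega⟩
        rw [h.neg_one_pow, this.neg_one_pow]
    rw [h1, h2]; ring

/-- The Jacobi identity of `Q_{2n}`. -/
theorem qBracket_jacobi (x y z : QCoord K n) :
    qBracket x (qBracket y z) = qBracket (qBracket x y) z + qBracket y (qBracket x z) := by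
  refine QCoord.ext_at fun k h1 hk => ?_
  rw [QCoord.coord_add, qBracket_swap (qBracket x y) z, ← neg_one_smul K (qBracket z _),
    QCoord.coord_smul]
  rcases hk.lt_or_eq with hk | rfl
  · rcases lt_or_ge k 3 with h | h
    · simp only [qBracket_at_low _ _ k h hk]; ring
    · simp only [qBracket_at_mid _ _ k h hk, qBracket_at_low _ _ 1 (by omega) (by omega : 1 < 2 * n)]
      rcases lt_or_ge (k - 1) 3 with h' | h'
      · simp only [qBracket_at_low _ _ (k - 1) h' (show k - 1 < 2 * n by omega)]; ring
      · simp only [qBracket_at_mid _ _ (k - 1) h' (show k - 1 < 2 * n by omega)]; ring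
  · rcases lt_or_ge n 2 with h | h
    · rw [qBracket_at_last _ _ (by omega), qBracket_at_last _ _ (by omega),
        qBracket_at_last _ _ (by omega), Finset.Icc_eq_empty (by omega)]
      simp
    · simp only [qBracket_qBracket_at_last _ _ _ h]
      rw [sum_Icc_symm n z.coord y.coord, sum_Icc_symm n z.coord x.coord, sum_Icc_symm n y.coord x.coord]
      ring

/-- The diagonal endomorphisms are derivations of `Q_{2n}`. -/
theorem torusAct_qBracket (a : Fin 2 → K) (x y : QCoord K n) :
    torusAct a (qBracket x y) = qBracket (torusAct a x) y + qBracket x (torusAct a y) := by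
  refine QCoord.ext_at fun k h1 hk => ?_
  rw [QCoord.coord_add, torusAct_at]
  rcases hk.lt_or_eq with hk | rfl
  · rcases lt_or_ge k 3 with h | h
    · simp only [qBracket_at_low _ _ k h hk]; ring
    · obtain ⟨m, rfl⟩ : ∃ m, k = m + 1 := ⟨k - 1, by omega⟩
      simp only [qBracket_at_mid _ _ _ h hk, torusAct_at, weightOne, weightTwo,
        if_neg (show ¬ (m + 1 = 2 * n) by omega), if_neg (show ¬ (m + 1 = 1) by omega),
        if_neg (show ¬ (1 = 2 * n) by omega), Nat.add_sub_cancel,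
        if_neg (show ¬ (m = 2 * n) by omega), if_neg (show ¬ (m = 1) by omega)]
      push_cast
      ring
  · rw [qBracket_at_last _ _ (by omega), qBracket_at_last _ _ (by omega),
      qBracket_at_last _ _ (by omega), Finset.mul_sum, ← Finset.sum_add_distrib]
    refine Finset.sum_congr rfl fun i hi => ?_
    simp only [Finset.mem_Icc] at hi
    simp only [torusAct_at, weightOne, weightTwo, if_true,
      if_neg (show ¬ (i = 2 * n) by omega), if_neg (show ¬ (i = 1) by omega),
      if_neg (show ¬ (2 * n + 1 - i = 2 * n) by omega),
      if_neg (show ¬ (2 * n + 1 - i = 1) by omega)]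
    rw [Nat.cast_sub (by omega)]
    push_cast
    ring

theorem torusAct_add_left (a b : Fin 2 → K) (x : QCoord K n) :
    torusAct (a + b) x = torusAct a x + torusAct b x := by
  funext k; simp only [torusAct, Pi.add_apply]; ring

theorem torusAct_add_right (a : Fin 2 → K) (x y : QCoord K n) :
    torusAct a (x + y) = torusAct a x + torusAct a y := by
  funext k; simp only [torusAct, Pi.add_apply]; ring

theorem torusAct_comm (a b : Fin 2 → K) (x : QCoord K n) :
    torusAct a (torusAct b x) = torusAct b (torusAct a x) := by
  funext k; simp only [torusAct]; ring

theorem torusAct_smul_left (t : K) (a : Fin 2 → K) (x : QCoord K n) :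
    torusAct (t • a) x = t • torusAct a x := by
  funext k; simp only [torusAct, Pi.smul_apply, smul_eq_mul]; ring

theorem torusAct_smul_right (t : K) (a : Fin 2 → K) (x : QCoord K n) :
    torusAct a (t • x) = t • torusAct a x := by
  funext k; simp only [torusAct, Pi.smul_apply, smul_eq_mul]; ring

theorem torusAct_neg_right (a : Fin 2 → K) (x : QCoord K n) :
    torusAct a (-x) = -torusAct a x := by
  funext k; simp only [torusAct, Pi.neg_apply]; ring

theorem qBracket_neg_right (x y : QCoord K n) : qBracket x (-y) = -qBracket x y := by
  rw [← neg_one_smul K y, qBracket_smul_right, neg_one_smul]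

end Bracket


/-- The nilpotent Lie algebra `Q_{2n}` with basis `X₁, …, X_{2n}`, as a space of coordinates. -/
def QAlg (K : Type*) (n : ℕ) : Type _ := QCoord K n

/-- The Lie algebra `r_{2n+2}` with basis `X₁, …, X_{2n}, Y₁, Y₂`, as a space of coordinates. -/
def RAlg (K : Type*) (n : ℕ) : Type _ := QCoord K n × (Fin 2 → K)

section Algebras

variable {K : Type*} [Field K] {n : ℕ}

instance : AddCommGroup (QAlg K n) := inferInstanceAs (AddCommGroup (QCoord K n))

instance : Module K (QAlg K n) := inferInstanceAs (Module K (QCoord K n))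

instance : AddCommGroup (RAlg K n) := inferInstanceAs (AddCommGroup (QCoord K n × (Fin 2 → K)))

instance : Module K (RAlg K n) := inferInstanceAs (Module K (QCoord K n × (Fin 2 → K)))

instance : LieRing (QAlg K n) where
  bracket x y := qBracket (K := K) (n := n) x y
  add_lie := qBracket_add_left (K := K) (n := n)
  lie_add := qBracket_add_right (K := K) (n := n)
  lie_self := qBracket_self (K := K) (n := n)
  leibniz_lie := qBracket_jacobi (K := K) (n := n)

instance : LieAlgebra K (QAlg K n) where
  lie_smul := qBracket_smul_right (K := K) (n := n)

/-- The bracket of `r_{2n+2}`: that of `Q_{2n}`, with `Y₁, Y₂` acting diagonally and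
`[Y₁, Y₂] = 0`. -/
def rBracket (p q : QCoord K n × (Fin 2 → K)) : QCoord K n × (Fin 2 → K) :=
  (qBracket p.1 q.1 + torusAct p.2 q.1 - torusAct q.2 p.1, 0)

theorem torusAct_zero_left (x : QCoord K n) : torusAct (0 : Fin 2 → K) x = 0 := by
  funext k; simp [torusAct]

theorem rBracket_jacobi (p q r : QCoord K n × (Fin 2 → K)) :
    rBracket p (rBracket q r) = rBracket (rBracket p q) r + rBracket q (rBracket p r) := by
  obtain ⟨x, a⟩ := p
  obtain ⟨y, b⟩ := q
  obtain ⟨z, c⟩ := r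
  refine Prod.ext ?_ (by simp [rBracket])
  simp only [rBracket, Prod.fst_add, torusAct_zero_left, sub_eq_add_neg, qBracket_add_right,
    qBracket_add_left, torusAct_add_right, torusAct_neg_right, qBracket_neg_right,
    torusAct_qBracket]
  rw [qBracket_jacobi x y z, torusAct_comm a b z, torusAct_comm a c y, torusAct_comm b c x,
    qBracket_swap (-torusAct b x) z, qBracket_swap (torusAct a y) z, qBracket_neg_right,
    qBracket_swap (torusAct b x) z, qBracket_swap y (torusAct c x), qBracket_swap z (torusAct b x),
    qBracket_swap z (torusAct a y)]
  abel

instance : LieRing (RAlg K n) where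
  bracket p q := rBracket (K := K) (n := n) p q
  add_lie p q r := by
    refine Prod.ext ?_ (zero_add (0 : Fin 2 → K)).symm
    change qBracket (p.1 + q.1) r.1 + torusAct (p.2 + q.2) r.1 - torusAct r.2 (p.1 + q.1) =
      (qBracket p.1 r.1 + torusAct p.2 r.1 - torusAct r.2 p.1) +
      (qBracket q.1 r.1 + torusAct q.2 r.1 - torusAct r.2 q.1)
    rw [qBracket_add_left, torusAct_add_left, torusAct_add_right]; abel
  lie_add p q r := by
    refine Prod.ext ?_ (zero_add (0 : Fin 2 → K)).symm
    change qBracket p.1 (q.1 + r.1) + torusAct p.2 (q.1 + r.1) - torusAct (q.2 + r.2) p.1 =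
      (qBracket p.1 q.1 + torusAct p.2 q.1 - torusAct q.2 p.1) +
      (qBracket p.1 r.1 + torusAct p.2 r.1 - torusAct r.2 p.1)
    rw [qBracket_add_right, torusAct_add_left, torusAct_add_right]; abel
  lie_self p := by
    refine Prod.ext ?_ rfl
    change qBracket p.1 p.1 + torusAct p.2 p.1 - torusAct p.2 p.1 = 0
    rw [qBracket_self]; abel
  leibniz_lie := rBracket_jacobi (K := K) (n := n)

instance : LieAlgebra K (RAlg K n) where
  lie_smul t p q := by
    refine Prod.ext ?_ (smul_zero t).symm
    change qBracket p.1 (t • q.1) + torusAct p.2 (t • q.1) - torusAct (t • q.2) p.1 =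
      t • (qBracket p.1 q.1 + torusAct p.2 q.1 - torusAct q.2 p.1)
    rw [qBracket_smul_right, torusAct_smul_left, torusAct_smul_right, smul_sub, smul_add]

end Algebras

section Table

variable {K : Type*} [Field K] {n : ℕ}

/-- The basis vector `X_i` of `Q_{2n}` for `1 ≤ i ≤ 2n` (and `0` for other `i`). -/
def qX (K : Type*) [Field K] (n i : ℕ) : QCoord K n := fun k => if (k : ℕ) = i then 1 else 0

/-- The basis vector `X_i` of `r_{2n+2}` for `1 ≤ i ≤ 2n` (and `0` for other `i`). -/
def rX (K : Type*) [Field K] (n i : ℕ) : QCoord K n × (Fin 2 → K) := (qX K n i, 0)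

/-- The basis vectors `Y₁ = Y 0` and `Y₂ = Y 1` of `r_{2n+2}`. -/
def rY (K : Type*) [Field K] (n : ℕ) (j : Fin 2) : QCoord K n × (Fin 2 → K) := ((0 : QCoord K n), Pi.single j 1)

theorem coord_qX (i k : ℕ) (hk : 1 ≤ k) (hk' : k ≤ 2 * n) :
    (qX K n i).coord k = if k = i then 1 else 0 := by
  rw [QCoord.coord, dif_pos (Finset.mem_Icc.2 ⟨hk, hk'⟩), qX]

/-- `[X₁, X_k] = X_{k+1}` for `2 ≤ k ≤ 2n-2`. -/
theorem qBracket_X_one (k : ℕ) (hk : 2 ≤ k) (hk' : k ≤ 2 * n - 2) :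
    qBracket (qX K n 1) (qX K n k) = qX K n (k + 1) := by
  refine QCoord.ext_at fun l h1 hl => ?_
  rw [coord_qX _ _ h1 hl]
  rcases hl.lt_or_eq with h | rfl
  · rcases lt_or_ge l 3 with h3 | h3
    · rw [qBracket_at_low _ _ l h3 h, if_neg (by omega)]
    · rw [qBracket_at_mid _ _ l h3 h, coord_qX _ _ (by omega) (by omega),
        coord_qX _ _ (by omega) (by omega), coord_qX _ _ (by omega) (by omega),
        coord_qX _ _ (by omega) (by omega), if_pos rfl, if_neg (by omega : ¬ 1 = k)]
      simp only [one_mul, zero_mul, sub_zero]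
      exact if_congr (by omega) rfl rfl
  · rw [qBracket_at_last _ _ (by omega), if_neg (by omega)]
    refine Finset.sum_eq_zero fun i hi => ?_
    simp only [Finset.mem_Icc] at hi
    rw [coord_qX _ _ (by omega) (by omega), if_neg (by omega)]; simp

/-- `[X_k, X_{2n+1-k}] = (-1)^k X_{2n}` for `2 ≤ k ≤ n`. -/
theorem qBracket_X_pair (k : ℕ) (hk : 2 ≤ k) (hk' : k ≤ n) :
    qBracket (qX K n k) (qX K n (2 * n + 1 - k)) = (-1 : K) ^ k • qX K n (2 * n) := by
  refine QCoord.ext_at fun l h1 hl => ?_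
  rw [QCoord.coord_smul, coord_qX _ _ h1 hl]
  rcases hl.lt_or_eq with h | rfl
  · rw [if_neg h.ne, mul_zero]
    rcases lt_or_ge l 3 with h3 | h3
    · rw [qBracket_at_low _ _ l h3 h]
    · rw [qBracket_at_mid _ _ l h3 h, coord_qX _ 1 (by omega) (by omega),
        coord_qX _ 1 (by omega) (by omega), if_neg (by omega), if_neg (by omega)]
      simp
  · rw [qBracket_at_last _ _ (by omega), if_pos rfl, Finset.sum_eq_single k]
    · rw [coord_qX _ _ (by omega) (by omega), coord_qX _ _ (by omega) (by omega)]; simp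
    · intro i hi hik
      simp only [Finset.mem_Icc] at hi
      rw [coord_qX _ _ (by omega) (by omega), if_neg hik]; simp
    · intro h; exact absurd (Finset.mem_Icc.2 ⟨hk, by omega⟩) h

/-- All other brackets `[X_i, X_j]` with `i < j` vanish. -/
theorem qBracket_X_eq_zero (i j : ℕ) (hi : 1 ≤ i) (hij : i < j) (hj : j ≤ 2 * n)
    (h1 : i = 1 → 2 * n - 1 ≤ j) (h2 : 2 ≤ i → i + j ≠ 2 * n + 1) :
    qBracket (qX K n i) (qX K n j) = 0 := by
  refine QCoord.ext_at fun l hl1 hl => ?_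
  have h0 : QCoord.coord (0 : QCoord K n) l = 0 := by
    unfold QCoord.coord; split_ifs <;> rfl
  rw [h0]
  rcases hl.lt_or_eq with h | rfl
  · rcases lt_or_ge l 3 with h3 | h3
    · rw [qBracket_at_low _ _ l h3 h]
    · rw [qBracket_at_mid _ _ l h3 h, coord_qX j 1 (by omega) (by omega),
        coord_qX j _ (by omega) (by omega), coord_qX i 1 (by omega) (by omega),
        if_neg (show ¬ 1 = j by omega)]
      by_cases hi1 : i = 1
      · rw [if_neg (show ¬ l - 1 = j by omega)]; simp
      · rw [if_neg (show ¬ 1 = i by omega)]; simp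
  · rw [qBracket_at_last _ _ (by omega)]
    refine Finset.sum_eq_zero fun m hm => ?_
    simp only [Finset.mem_Icc] at hm
    rw [coord_qX _ _ (by omega) (by omega), coord_qX _ _ (by omega) (by omega)]
    by_cases hmi : m = i
    · rw [if_neg (show ¬ 2 * n + 1 - m = j by omega)]; simp
    · rw [if_neg hmi]; simp

/-- `Q_{2n}` is the subalgebra of `r_{2n+2}` spanned by the `X_i`. -/
theorem rBracket_X_X (i j : ℕ) : rBracket (rX K n i) (rX K n j) =
    (qBracket (qX K n i) (qX K n j), (0 : Fin 2 → K)) := by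
  change rBracket (qX K n i, 0) (qX K n j, 0) = _
  refine Prod.ext ?_ rfl
  change qBracket _ _ + torusAct 0 _ - torusAct 0 _ = qBracket _ _
  rw [torusAct_zero_left, torusAct_zero_left, add_zero, sub_zero]

theorem rBracket_Y_X (j : Fin 2) (k : ℕ) : rBracket (rY K n j) (rX K n k) =
    (if j = 0 then weightOne K n k else weightTwo K n k) • rX K n k := by
  change rBracket ((0 : QCoord K n), Pi.single j 1) (qX K n k, 0) = _
  refine Prod.ext ?_ (smul_zero _).symm
  change qBracket 0 _ + torusAct _ _ - torusAct 0 0 = _ • qX K n k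
  have h0 : qBracket (0 : QCoord K n) (qX K n k) = 0 := by
    funext l; simp [qBracket, QCoord.coord]
  rw [h0, torusAct_zero_left, zero_add, sub_zero]
  funext l
  fin_cases j <;> by_cases h : (l : ℕ) = k <;>
    simp [torusAct, qX, h]

/-- `[Y₁, X_k] = k X_k` for `1 ≤ k ≤ 2n-1`. -/
theorem rBracket_Y_one_X (k : ℕ) (hk : k ≠ 2 * n) :
    rBracket (rY K n 0) (rX K n k) = (k : K) • rX K n k := by
  rw [rBracket_Y_X, if_pos rfl, weightOne, if_neg hk]

/-- `[Y₁, X_{2n}] = (2n+1) X_{2n}`. -/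
theorem rBracket_Y_one_X_last :
    rBracket (rY K n 0) (rX K n (2 * n)) = (2 * n + 1 : K) • rX K n (2 * n) := by
  rw [rBracket_Y_X, if_pos rfl, weightOne, if_pos rfl]

/-- `[Y₂, X₁] = 0`. -/
theorem rBracket_Y_two_X_one : rBracket (rY K n 1) (rX K n 1) = 0 := by
  rw [rBracket_Y_X, if_neg one_ne_zero, weightTwo, if_neg (by omega), if_pos rfl, zero_smul]

/-- `[Y₂, X_k] = X_k` for `2 ≤ k ≤ 2n-1`. -/
theorem rBracket_Y_two_X (k : ℕ) (hk : 2 ≤ k) (hk' : k ≠ 2 * n) :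
    rBracket (rY K n 1) (rX K n k) = rX K n k := by
  rw [rBracket_Y_X, if_neg one_ne_zero, weightTwo, if_neg hk', if_neg (by omega), one_smul]

/-- `[Y₂, X_{2n}] = 2 X_{2n}`. -/
theorem rBracket_Y_two_X_last :
    rBracket (rY K n 1) (rX K n (2 * n)) = (2 : K) • rX K n (2 * n) := by
  rw [rBracket_Y_X, if_neg one_ne_zero, weightTwo, if_pos rfl]

/-- `[Y₁, Y₂] = 0`. -/
theorem rBracket_Y_Y (i j : Fin 2) : rBracket (rY K n i) (rY K n j) = 0 := by
  change rBracket ((0 : QCoord K n), Pi.single i 1) ((0 : QCoord K n), Pi.single j 1) = 0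
  refine Prod.ext ?_ rfl
  funext l
  simp [rBracket, qBracket, torusAct, QCoord.coord]

end Table

/-! ### Derivations of Q_{2n}: triangular form, weights, eigenvectors. -/

section Derivations

variable {K : Type*} [Field K] {n : ℕ}

/-! Every derivation of Q_{2n} preserves the flag of spans of X_k, …, X_{2n}. Since X_1 and X_2
generate the algebra, its diagonal is determined by the weights (a, b) of X_1 and X_2
(`IsQDerivation.coord_of_mem_qFlag`). Derivations with a = b = 0 are nilpotent; inner derivations
are of this kind.

Let L be solvable of dimension 2n+2 with nilradical N ≅ Q_{2n}. Reading (a, b) off the adjoint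
action on N gives a linear map `adDiag` from L to K × K that kills N and all brackets, because
diagonals of triangular maps multiply. Engel's theorem and a descent along the derived series show
that its kernel is exactly N (`adDiagKer_eq`), so by dimension it is onto.

Choose h in L with weights (1, 2n). Its weights on N are 1, the integers from 2n to 4n-3, and 6n-3.
They are nonzero, so an element y with weights (0, 1) can be corrected inside N to commute with h.
They are distinct, so h has eigenvectors v and w with leading terms X_1 and X_2, and everything
commuting with h is diagonal on them. For two different basis vectors, the sum of their weights is
again a weight only where Q_{2n} has a nonzero bracket, so the iterated brackets of v and w satisfy
the relations of Q_{2n} (`exists_diagonalizing_automorphism`). In this frame suitable combinations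
of h and y act as Y_1 and Y_2, and they commute; this is r_{2n+2}.

For r_{2n+2} itself, an element of a nilpotent ideal acts nilpotently on the span of the X_i, so its
weights vanish and with them its Y-components (`RAlg.le_nilIdeal`). -/

theorem QCoord.coord_zero (k : ℕ) : (0 : QCoord K n).coord k = 0 := by
  unfold QCoord.coord; split_ifs <;> rfl

theorem QCoord.coord_sub (x y : QCoord K n) (k : ℕ) :
    (x - y).coord k = x.coord k - y.coord k := by
  unfold QCoord.coord; split_ifs <;> simp

theorem QCoord.coord_of_lt_one (x : QCoord K n) (k : ℕ) (hk : k < 1) : x.coord k = 0 := by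
  unfold QCoord.coord; rw [dif_neg]; simp only [Finset.mem_Icc]; omega

theorem QCoord.coord_of_gt (x : QCoord K n) (k : ℕ) (hk : 2 * n < k) : x.coord k = 0 := by
  unfold QCoord.coord; rw [dif_neg]; simp only [Finset.mem_Icc]; omega

/-- The `k`-th coordinate as a linear form. -/
def coordForm (K : Type*) [Field K] (n k : ℕ) : QCoord K n →ₗ[K] K where
  toFun x := x.coord k
  map_add' x y := QCoord.coord_add x y k
  map_smul' t x := QCoord.coord_smul t x k

theorem coord_sum {ι : Type*} (s : Finset ι) (f : ι → QCoord K n) (k : ℕ) :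
    (∑ i ∈ s, f i).coord k = ∑ i ∈ s, (f i).coord k :=
  map_sum (coordForm K n k) f s

theorem eq_sum_qX (x : QCoord K n) :
    x = ∑ i ∈ Finset.Icc 1 (2 * n), x.coord i • qX K n i := by
  refine QCoord.ext_at fun k h1 hk => ?_
  rw [coord_sum, Finset.sum_eq_single k]
  · rw [QCoord.coord_smul, coord_qX _ _ h1 hk, if_pos rfl, mul_one]
  · intro i _ hik
    rw [QCoord.coord_smul, coord_qX _ _ h1 hk, if_neg (Ne.symm hik), mul_zero]
  · intro h; exact absurd (Finset.mem_Icc.2 ⟨h1, hk⟩) h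

/-- A linear endomorphism of `Q_{2n}` that is a derivation of the bracket. -/
def IsQDerivation (D : QCoord K n →ₗ[K] QCoord K n) : Prop :=
  ∀ x y, D (qBracket x y) = qBracket (D x) y + qBracket x (D y)

/-- The weight of `X_k` under the derivation for which `X₁` and `X₂` have weights `a` and `b`. -/
def qWeight (n : ℕ) (a b : K) (k : ℕ) : K :=
  if k = 1 then a else if k = 2 * n then (2 * (n : K) - 3) * a + 2 * b else ((k : K) - 2) * a + b

/-- The diagonal entries on `X₁` and `X₂` of an endomorphism of `Q_{2n}`. -/
def diagPair (D : QCoord K n →ₗ[K] QCoord K n) : K × K :=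
  ((D (qX K n 1)).coord 1, (D (qX K n 2)).coord 2)

/-- The weights of the diagonal part of a derivation of `Q_{2n}`. -/
abbrev IsQDerivation.weight (D : QCoord K n →ₗ[K] QCoord K n) (k : ℕ) : K :=
  qWeight n (diagPair D).1 (diagPair D).2 k

theorem qBracket_zero_left (y : QCoord K n) : qBracket 0 y = 0 := by
  funext l; simp [qBracket, QCoord.coord_zero]

/-- Apply D to [X_2, X_3] = 0, a relation that needs n ≥ 3, and compare X_4-coordinates: an
X_1-component of D X_2 would produce a multiple of [X_1, X_3] = X_4 that nothing cancels. -/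
theorem IsQDerivation.coord_X_two_one (hn : 3 ≤ n) {D : QCoord K n →ₗ[K] QCoord K n}
    (hD : IsQDerivation D) : (D (qX K n 2)).coord 1 = 0 := by
  have h := hD (qX K n 2) (qX K n 3)
  rw [qBracket_X_eq_zero 2 3 (by omega) (by omega) (by omega) (by omega) (by omega), map_zero] at h
  have h4 := congrArg (fun x => QCoord.coord x 4) h
  simp only [QCoord.coord_add, QCoord.coord_zero] at h4
  rw [qBracket_at_mid _ _ 4 (by omega) (by omega), qBracket_at_mid _ _ 4 (by omega) (by omega)] at h4
  rw [coord_qX _ _ (by omega) (by omega), coord_qX _ _ (by omega) (by omega),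
    coord_qX _ _ (by omega) (by omega), coord_qX _ _ (by omega) (by omega)] at h4
  simpa using h4.symm

/-- A derivation is triangular on `X₂, …, X_{2n-1}`. -/
theorem IsQDerivation.coord_X_mid (hn : 3 ≤ n) {D : QCoord K n →ₗ[K] QCoord K n}
    (hD : IsQDerivation D) (k : ℕ) (hk : 2 ≤ k) (hk' : k < 2 * n) :
    (∀ l < k, (D (qX K n k)).coord l = 0) ∧
      (D (qX K n k)).coord k = IsQDerivation.weight D k := by
  induction k, hk using Nat.le_induction with
  | base =>
    refine ⟨fun l hl => ?_, ?_⟩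
    · rcases lt_or_ge l 1 with h | h
      · exact QCoord.coord_of_lt_one _ _ h
      · obtain rfl : l = 1 := by omega
        exact hD.coord_X_two_one hn
    · rw [IsQDerivation.weight, qWeight, if_neg (by omega), if_neg (by omega)]
      simp [diagPair]
  | succ k hk ih =>
    obtain ⟨ih1, ih2⟩ := ih (by omega)
    -- Since X_{k+1} = [X_1, X_k], its image is [D X_1, X_k] + [X_1, D X_k]. In these coordinates
    -- the first bracket contributes only the weight of X_1, at X_{k+1}, and the second shifts D X_k
    -- by one place.
    have key : ∀ l, 3 ≤ l → l < 2 * n → (D (qX K n (k + 1))).coord l =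
        (diagPair D).1 * (if l = k + 1 then 1 else 0) + (D (qX K n k)).coord (l - 1) := by
      intro l h3 hl
      rw [← qBracket_X_one k hk (by omega), hD, QCoord.coord_add,
        qBracket_at_mid _ _ l h3 hl, qBracket_at_mid _ _ l h3 hl, coord_qX k 1 (by omega) (by omega),
        coord_qX 1 1 (by omega) (by omega), coord_qX k (l - 1) (by omega) (by omega), ih1 1 (by omega),
        if_pos rfl, if_neg (show ¬ 1 = k by omega)]
      simp only [zero_mul, sub_zero, one_mul, diagPair]
      congr 2
      exact if_congr (by omega) rfl rfl
    refine ⟨fun l hl => ?_, ?_⟩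
    · rcases lt_or_ge l 3 with h | h
      · rw [← qBracket_X_one k hk (by omega), hD, QCoord.coord_add,
          qBracket_at_low _ _ l h (by omega), qBracket_at_low _ _ l h (by omega), add_zero]
      · rw [key l h (by omega), if_neg (by omega), ih1 _ (by omega)]; simp
    · rw [key _ (by omega) hk', if_pos rfl, Nat.add_sub_cancel, ih2]
      simp only [IsQDerivation.weight, qWeight]
      rw [if_neg (by omega), if_neg (by omega), if_neg (by omega), if_neg (by omega)]
      push_cast; ring

/-- Use X_{2n} = [X_2, X_{2n-1}]: the weights b and (2n-3)a + b add up. The lower coordinates vanish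
because neither X_2, X_{2n-1} nor their images have an X_1-component. -/
theorem IsQDerivation.coord_X_last (hn : 3 ≤ n) {D : QCoord K n →ₗ[K] QCoord K n}
    (hD : IsQDerivation D) :
    (∀ l < 2 * n, (D (qX K n (2 * n))).coord l = 0) ∧
      (D (qX K n (2 * n))).coord (2 * n) = IsQDerivation.weight D (2 * n) := by
  obtain ⟨h1, h2⟩ := hD.coord_X_mid hn (2 * n - 1) (by omega) (by omega)
  have hX : qX K n (2 * n) = qBracket (qX K n 2) (qX K n (2 * n - 1)) := by
    have := qBracket_X_pair (K := K) (n := n) 2 le_rfl (by omega)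
    rw [show 2 * n - 1 = 2 * n + 1 - 2 by omega, this]; simp
  rw [hX, hD]
  refine ⟨fun l hl => ?_, ?_⟩
  · rw [QCoord.coord_add]
    rcases lt_or_ge l 3 with h | h
    · rw [qBracket_at_low _ _ l h (by omega), qBracket_at_low _ _ l h (by omega), add_zero]
    · rw [qBracket_at_mid _ _ l h hl, qBracket_at_mid _ _ l h hl, hD.coord_X_two_one hn,
        h1 1 (by omega), coord_qX _ 1 (by omega) (by omega), coord_qX _ 1 (by omega) (by omega),
        if_neg (by omega), if_neg (by omega)]
      simp
  · rw [QCoord.coord_add, qBracket_at_last _ _ (by omega), qBracket_at_last _ _ (by omega),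
      Finset.sum_eq_single 2, Finset.sum_eq_single 2, coord_qX _ _ (by omega) (by omega),
      coord_qX _ _ (by omega) (by omega), if_pos (by omega), if_pos rfl,
      show 2 * n + 1 - 2 = 2 * n - 1 by omega, h2]
    · simp only [IsQDerivation.weight, qWeight]
      rw [if_neg (by omega), if_neg (by omega), if_neg (by omega), if_pos trivial,
        Nat.cast_sub (by omega)]
      push_cast; simp only [diagPair]; ring
    · intro i hi hi2
      rw [Finset.mem_Icc] at hi
      rw [coord_qX _ _ (by omega) (by omega), if_neg hi2]; simp
    · intro h; exact absurd (Finset.mem_Icc.2 ⟨le_rfl, by omega⟩) h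
    · intro i hi hi2
      rw [Finset.mem_Icc] at hi
      rw [coord_qX _ _ (by omega) (by omega), if_neg (by omega)]; simp
    · intro h; exact absurd (Finset.mem_Icc.2 ⟨le_rfl, by omega⟩) h

theorem IsQDerivation.coord_X (hn : 3 ≤ n) {D : QCoord K n →ₗ[K] QCoord K n}
    (hD : IsQDerivation D) (k : ℕ) (hk : 1 ≤ k) (hk' : k ≤ 2 * n) :
    (∀ l < k, (D (qX K n k)).coord l = 0) ∧
      (D (qX K n k)).coord k = IsQDerivation.weight D k := by
  rcases hk.eq_or_lt with rfl | h1
  · exact ⟨fun l hl => QCoord.coord_of_lt_one _ _ hl, by simp [IsQDerivation.weight, qWeight, diagPair]⟩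
  · rcases hk'.eq_or_lt with rfl | h2
    · exact hD.coord_X_last hn
    · exact hD.coord_X_mid hn k h1 h2

/-- The span of `X_k, …, X_{2n}`. -/
def qFlag (K : Type*) [Field K] (n k : ℕ) : Submodule K (QCoord K n) where
  carrier := {x | ∀ l < k, x.coord l = 0}
  zero_mem' l _ := QCoord.coord_zero l
  add_mem' hx hy l hl := by rw [QCoord.coord_add, hx l hl, hy l hl, add_zero]
  smul_mem' t x hx l hl := by rw [QCoord.coord_smul, hx l hl, mul_zero]

theorem mem_qFlag {k : ℕ} {x : QCoord K n} : x ∈ qFlag K n k ↔ ∀ l < k, x.coord l = 0 := Iff.rfl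

theorem mem_qFlag_succ {k : ℕ} {x : QCoord K n} :
    x ∈ qFlag K n (k + 1) ↔ x ∈ qFlag K n k ∧ x.coord k = 0 := by
  simp only [mem_qFlag]
  refine ⟨fun h => ⟨fun l hl => h l (by omega), h k (by omega)⟩, fun h l hl => ?_⟩
  rcases Nat.lt_succ_iff_lt_or_eq.1 hl with h' | rfl
  exacts [h.1 l h', h.2]

theorem mem_qFlag_one (x : QCoord K n) : x ∈ qFlag K n 1 :=
  fun _ hl => QCoord.coord_of_lt_one _ _ hl

theorem eq_zero_of_mem_qFlag {k : ℕ} (hk : 2 * n < k) {x : QCoord K n} (hx : x ∈ qFlag K n k) :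
    x = 0 :=
  QCoord.ext_at fun l _ hl => by rw [hx l (by omega), QCoord.coord_zero]

/-- Triangularity in the form used from here on: D acts on each one-dimensional flag quotient by the
weight. Outside 1 ≤ k ≤ 2n both sides of the equation are zero by the convention for `QCoord.coord`.
-/
theorem IsQDerivation.coord_of_mem_qFlag (hn : 3 ≤ n) {D : QCoord K n →ₗ[K] QCoord K n}
    (hD : IsQDerivation D) {k : ℕ} {x : QCoord K n} (hx : x ∈ qFlag K n k) :
    D x ∈ qFlag K n k ∧ (D x).coord k = IsQDerivation.weight D k * x.coord k := by
  have hs : ∀ l, (D x).coord l =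
      ∑ i ∈ Finset.Icc 1 (2 * n), x.coord i * (D (qX K n i)).coord l := by
    intro l
    conv_lhs => rw [eq_sum_qX x]
    rw [map_sum, coord_sum]
    exact Finset.sum_congr rfl fun i _ => by rw [map_smul, QCoord.coord_smul]
  refine ⟨fun l hl => ?_, ?_⟩
  · rw [hs]
    refine Finset.sum_eq_zero fun i hi => ?_
    rw [Finset.mem_Icc] at hi
    rcases lt_or_ge i k with h | h
    · rw [hx i h, zero_mul]
    · rw [(hD.coord_X hn i hi.1 hi.2).1 l (by omega), mul_zero]
  · rw [hs, Finset.sum_eq_single k]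
    · by_cases h : 1 ≤ k ∧ k ≤ 2 * n
      · rw [(hD.coord_X hn k h.1 h.2).2, mul_comm]
      · rcases lt_or_ge k 1 with h' | h'
        · simp [QCoord.coord_of_lt_one _ _ h']
        · simp [QCoord.coord_of_gt x k (by omega)]
    · intro i hi hik
      rw [Finset.mem_Icc] at hi
      rcases lt_or_ge i k with h | h
      · rw [hx i h, zero_mul]
      · rw [(hD.coord_X hn i hi.1 hi.2).1 k (by omega), mul_zero]
    · intro h
      rw [Finset.mem_Icc, not_and_or] at h
      rcases h with h | h
      · rw [QCoord.coord_of_lt_one _ _ (by omega), zero_mul]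
      · rw [QCoord.coord_of_gt x _ (by omega), zero_mul]

theorem qWeight_zero (k : ℕ) : qWeight n (0 : K) 0 k = 0 := by
  unfold qWeight; split_ifs <;> simp

/-- A derivation with zero diagonal is nilpotent. -/
theorem IsQDerivation.pow_eq_zero (hn : 3 ≤ n) {D : QCoord K n →ₗ[K] QCoord K n}
    (hD : IsQDerivation D) (h0 : diagPair D = 0) : D ^ (2 * n) = 0 := by
  -- With all weights zero, each application of D climbs one step of the flag, which starts at index
  -- 1.
  have h : ∀ (m : ℕ) (x : QCoord K n), (D ^ m) x ∈ qFlag K n (m + 1) := by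
    intro m x
    induction m with
    | zero => exact mem_qFlag_one _
    | succ m ih =>
      rw [pow_succ', Module.End.mul_apply, mem_qFlag_succ]
      have := hD.coord_of_mem_qFlag hn ih
      refine ⟨this.1, ?_⟩
      rw [this.2, IsQDerivation.weight, h0, Prod.fst_zero, Prod.snd_zero, qWeight_zero, zero_mul]
  exact LinearMap.ext fun x => eq_zero_of_mem_qFlag (Nat.lt_succ_self _) (h _ x)

/-- Diagonals of triangular maps multiply entrywise. The composite need not be a derivation; the
point is that commutators have zero diagonal. -/
theorem IsQDerivation.diagPair_comp (hn : 3 ≤ n) {D E : QCoord K n →ₗ[K] QCoord K n}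
    (hD : IsQDerivation D) (hE : IsQDerivation E) :
    diagPair (D ∘ₗ E) = diagPair D * diagPair E := by
  refine Prod.ext ?_ ?_
  · have h := (hD.coord_of_mem_qFlag hn (mem_qFlag_one (E (qX K n 1)))).2
    simpa [diagPair, IsQDerivation.weight, qWeight] using h
  · have h2 : E (qX K n 2) ∈ qFlag K n 2 := (hE.coord_X hn 2 (by omega) (by omega)).1
    have h := (hD.coord_of_mem_qFlag hn h2).2
    simpa [diagPair, IsQDerivation.weight, qWeight, show ¬ (2 = 2 * n) by omega] using h

/-- A vector in the kernel of `D - μ` vanishes if its coordinates of weight `μ` do. -/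
theorem IsQDerivation.eq_zero_of_apply_eq_smul (hn : 3 ≤ n) {D : QCoord K n →ₗ[K] QCoord K n}
    (hD : IsQDerivation D) {μ : K} {x : QCoord K n} (hx : D x = μ • x)
    (h : ∀ k, 1 ≤ k → k ≤ 2 * n → IsQDerivation.weight D k = μ → x.coord k = 0) : x = 0 := by
  -- The leading coordinate x_k satisfies weight(k) x_k = μ x_k, so it vanishes either by
  -- cancellation or by hypothesis; then pass to the next flag step.
  have hF : ∀ k, x ∈ qFlag K n k := by
    intro k
    induction k with
    | zero => exact fun l hl => absurd hl (by omega)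
    | succ k ih =>
      rw [mem_qFlag_succ]
      refine ⟨ih, ?_⟩
      rcases lt_or_ge k 1 with h1 | h1
      · exact QCoord.coord_of_lt_one _ _ h1
      rcases lt_or_ge (2 * n) k with h2 | h2
      · exact QCoord.coord_of_gt _ _ h2
      have hk := (hD.coord_of_mem_qFlag hn ih).2
      rw [hx, QCoord.coord_smul] at hk
      by_cases hw : IsQDerivation.weight D k = μ
      · exact h k h1 h2 hw
      · by_contra hne
        exact hw (mul_right_cancel₀ hne hk).symm
  exact eq_zero_of_mem_qFlag (Nat.lt_succ_self _) (hF _)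

/-- A derivation whose weights differ from `0` is surjective. -/
theorem IsQDerivation.surjective (hn : 3 ≤ n) {D : QCoord K n →ₗ[K] QCoord K n}
    (hD : IsQDerivation D) (h : ∀ k, 1 ≤ k → k ≤ 2 * n → IsQDerivation.weight D k ≠ 0) :
    Function.Surjective D := by
  rw [← LinearMap.injective_iff_surjective, injective_iff_map_eq_zero]
  intro x hx
  exact hD.eq_zero_of_apply_eq_smul hn (μ := 0) (by rw [hx, zero_smul])
    fun k h1 h2 h3 => absurd h3 (h k h1 h2)

/-- A derivation has an eigenvector with leading term `X_k` if the weight of `X_k` is simple. -/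
theorem IsQDerivation.exists_eigenvector (hn : 3 ≤ n) {D : QCoord K n →ₗ[K] QCoord K n}
    (hD : IsQDerivation D) (k : ℕ) (hk : 1 ≤ k) (hk' : k ≤ 2 * n)
    (h : ∀ l, k < l → l ≤ 2 * n → IsQDerivation.weight D l ≠ IsQDerivation.weight D k) :
    ∃ v ∈ qFlag K n k, v.coord k = 1 ∧ D v = IsQDerivation.weight D k • v := by
  set μ := IsQDerivation.weight D k
  set E : QCoord K n →ₗ[K] QCoord K n := D - μ • LinearMap.id
  have hEx : ∀ x, E x = D x - μ • x := fun x => rfl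
  have hmem : ∀ x ∈ qFlag K n k, E x ∈ qFlag K n (k + 1) := by
    intro x hx
    have := hD.coord_of_mem_qFlag hn hx
    rw [mem_qFlag_succ]
    rw [hEx]
    refine ⟨sub_mem this.1 ((qFlag K n k).smul_mem _ hx), ?_⟩
    simp [QCoord.coord_sub, QCoord.coord_smul, this.2, μ]
  have hle : ∀ x ∈ qFlag K n (k + 1), E x ∈ qFlag K n (k + 1) :=
    fun x hx => hmem x (mem_qFlag_succ.1 hx).1
  -- Beyond X_k no weight equals μ, so D - μ is injective there, hence onto by finite dimension.
  -- Subtracting from X_k a preimage of (D - μ) X_k yields the eigenvector without changing the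
  -- leading term.
  have hsurj : Function.Surjective (E.restrict hle) := by
    rw [← LinearMap.injective_iff_surjective, injective_iff_map_eq_zero]
    rintro ⟨x, hx⟩ h0
    have h0' : D x = μ • x := by
      have := congrArg Subtype.val h0
      simpa [hEx, sub_eq_zero] using this
    refine Subtype.ext (hD.eq_zero_of_apply_eq_smul hn h0' fun l h1 h2 h3 => ?_)
    rcases lt_or_ge k l with hl | hl
    · exact absurd h3 (h l hl h2)
    · exact hx l (by omega)
  have hX : qX K n k ∈ qFlag K n k := by
    intro l hl
    rcases lt_or_ge l 1 with h1 | h1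
    · exact QCoord.coord_of_lt_one _ _ h1
    · rw [coord_qX _ _ h1 (by omega), if_neg (by omega)]
  obtain ⟨⟨u, hu⟩, hu'⟩ := hsurj ⟨_, hmem _ hX⟩
  have hu'' := congrArg Subtype.val hu'
  have hu2 := mem_qFlag_succ.1 hu
  refine ⟨qX K n k - u, sub_mem hX hu2.1, ?_, ?_⟩
  · rw [QCoord.coord_sub, hu2.2, coord_qX _ _ hk hk', if_pos rfl, sub_zero]
  · have : D u - μ • u = D (qX K n k) - μ • qX K n k := hu''
    rw [map_sub, smul_sub, sub_eq_sub_iff_sub_eq_sub, ← this]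

/-- The bracket as a bilinear map. -/
def qBracketHom (K : Type*) [Field K] (n : ℕ) :
    QCoord K n →ₗ[K] QCoord K n →ₗ[K] QCoord K n :=
  LinearMap.mk₂ K qBracket qBracket_add_left
    (fun t x y => by
      rw [qBracket_swap, qBracket_smul_right, qBracket_swap x, smul_neg])
    qBracket_add_right qBracket_smul_right

/-- The diagonal action as a bilinear map. -/
def torusHom (K : Type*) [Field K] (n : ℕ) :
    (Fin 2 → K) →ₗ[K] QCoord K n →ₗ[K] QCoord K n :=
  LinearMap.mk₂ K torusAct torusAct_add_left torusAct_smul_left torusAct_add_right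
    torusAct_smul_right

theorem torusHom_apply (a : Fin 2 → K) (y : QCoord K n) : torusHom K n a y = torusAct a y := rfl

theorem IsQDerivation.add {D E : QCoord K n →ₗ[K] QCoord K n}
    (hD : IsQDerivation D) (hE : IsQDerivation E) : IsQDerivation (D + E) := by
  intro x y
  simp only [LinearMap.add_apply, hD x y, hE x y, qBracket_add_left, qBracket_add_right]
  abel

theorem isQDerivation_qBracketHom (x : QCoord K n) : IsQDerivation (qBracketHom K n x) :=
  fun y z => qBracket_jacobi x y z

theorem isQDerivation_torusHom (a : Fin 2 → K) : IsQDerivation (torusHom K n a) :=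
  fun y z => torusAct_qBracket a y z

theorem diagPair_qBracketHom (hn : 3 ≤ n) (x : QCoord K n) : diagPair (qBracketHom K n x) = 0 :=
  Prod.ext (qBracket_at_low _ _ _ (by omega) (by omega))
    (qBracket_at_low _ _ _ (by omega) (by omega))

/-- Y_1 has weights (1, 2) on X_1, X_2 and Y_2 has weights (0, 1). This is the origin of the pair (a
0, 2 * a 0 + a 1) below. -/
theorem diagPair_torusHom (hn : 3 ≤ n) (a : Fin 2 → K) :
    diagPair (torusHom K n a) = (a 0, 2 * a 0 + a 1) := by
  refine Prod.ext ?_ ?_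
  · change (torusAct a (qX K n 1)).coord 1 = _
    rw [torusAct_at, coord_qX _ _ (by omega) (by omega), weightOne, weightTwo]
    simp [show ¬ 1 = 2 * n by omega]
  · change (torusAct a (qX K n 2)).coord 2 = _
    rw [torusAct_at, coord_qX _ _ (by omega) (by omega), weightOne, weightTwo]
    simp [show ¬ n = 1 by omega, mul_comm]

/-- The diagonal entries on `X₁` and `X₂` as a linear map. -/
def diagPairHom (K : Type*) [Field K] (n : ℕ) : (QCoord K n →ₗ[K] QCoord K n) →ₗ[K] K × K where
  toFun := diagPair
  map_add' D E := by simp [diagPair, QCoord.coord_add]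
  map_smul' t D := by simp [diagPair, QCoord.coord_smul]

end Derivations

/-! ### The algebra r_{2n+2}: solvability, dimension, nilradical. -/

section Standard

variable {K : Type*} [Field K] {n : ℕ}

instance : FiniteDimensional K (QAlg K n) := inferInstanceAs (FiniteDimensional K (QCoord K n))

instance : FiniteDimensional K (RAlg K n) :=
  inferInstanceAs (FiniteDimensional K (QCoord K n × (Fin 2 → K)))

theorem QAlg.lie_def (x y : QAlg K n) : ⁅x, y⁆ = qBracket (K := K) (n := n) x y := rfl

theorem RAlg.lie_def (p q : RAlg K n) :
    ⁅p, q⁆ = ((qBracket p.1 q.1 + torusAct p.2 q.1 - torusAct q.2 p.1, 0) :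
      QCoord K n × (Fin 2 → K)) := rfl

/-- Engel's theorem: inner derivations have zero diagonal, hence are nilpotent. -/
theorem QAlg.isNilpotent (hn : 3 ≤ n) : LieRing.IsNilpotent (QAlg K n) := by
  rw [LieAlgebra.isNilpotent_iff_forall (R := K)]
  intro x
  exact ⟨2 * n, (isQDerivation_qBracketHom (K := K) (n := n) x).pow_eq_zero hn
    (diagPair_qBracketHom hn x)⟩

/-- The element of `r_{2n+2}` with given coordinates. -/
def RAlg.mk (x : QCoord K n) (a : Fin 2 → K) : RAlg K n := (x, a)

/-- The span of the `X_i` in `r_{2n+2}`. -/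
def RAlg.nilIdeal (K : Type*) [Field K] (n : ℕ) : LieIdeal K (RAlg K n) where
  carrier := {p | p.2 = 0}
  zero_mem' := rfl
  add_mem' {p q} hp hq := by
    change p.2 + q.2 = 0
    rw [show p.2 = 0 from hp, show q.2 = 0 from hq, add_zero]
  smul_mem' t p hp := by
    change t • p.2 = 0
    rw [show p.2 = 0 from hp, smul_zero]
  lie_mem {_ _} _ := rfl

theorem RAlg.mem_nilIdeal {p : RAlg K n} : p ∈ RAlg.nilIdeal K n ↔ p.2 = 0 := Iff.rfl

/-- The span of the `X_i` in `r_{2n+2}` is `Q_{2n}`. -/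
def RAlg.nilIdealEquiv (K : Type*) [Field K] (n : ℕ) : RAlg.nilIdeal K n ≃ₗ⁅K⁆ QAlg K n where
  toFun p := p.1.1
  map_add' _ _ := rfl
  map_smul' _ _ := rfl
  map_lie' {p q} := by
    change qBracket p.1.1 q.1.1 + torusAct p.1.2 q.1.1 - torusAct q.1.2 p.1.1 =
      qBracket p.1.1 q.1.1
    rw [RAlg.mem_nilIdeal.1 p.2, RAlg.mem_nilIdeal.1 q.2, torusAct_zero_left, torusAct_zero_left,
      add_zero, sub_zero]
  invFun x := ⟨(x, 0), rfl⟩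
  left_inv p := Subtype.ext (Prod.ext rfl (RAlg.mem_nilIdeal.1 p.2).symm)
  right_inv _ := rfl

theorem RAlg.isNilpotent_nilIdeal (hn : 3 ≤ n) : LieRing.IsNilpotent (RAlg.nilIdeal K n) :=
  (LieEquiv.nilpotent_iff_equiv_nilpotent (RAlg.nilIdealEquiv K n)).2 (QAlg.isNilpotent hn)

theorem RAlg.isSolvable (hn : 3 ≤ n) : LieAlgebra.IsSolvable (RAlg K n) := by
  have := RAlg.isNilpotent_nilIdeal (K := K) hn
  have hs : LieAlgebra.IsSolvable (RAlg.nilIdeal K n) := inferInstance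
  obtain ⟨k, hk⟩ := (LieAlgebra.isSolvable_iff K _).1 hs
  rw [LieIdeal.derivedSeries_eq_bot_iff] at hk
  have h1 : LieAlgebra.derivedSeriesOfIdeal K (RAlg K n) 1 ⊤ ≤ RAlg.nilIdeal K n := by
    rw [LieAlgebra.derivedSeriesOfIdeal_succ, LieSubmodule.lie_le_iff]
    intro p _ q _
    rfl
  refine LieAlgebra.IsSolvable.mk (R := K) (k := k + 1) ?_
  rw [LieAlgebra.derivedSeries_def, LieAlgebra.derivedSeriesOfIdeal_add, eq_bot_iff, ← hk]
  exact LieAlgebra.derivedSeriesOfIdeal_mono h1 k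

theorem RAlg.finrank_eq (K : Type*) [Field K] (n : ℕ) :
    Module.finrank K (RAlg K n) = 2 * n + 2 := by
  change Module.finrank K (QCoord K n × (Fin 2 → K)) = _
  rw [Module.finrank_prod, Module.finrank_pi, Module.finrank_pi]
  simp

theorem QAlg.finrank_eq (K : Type*) [Field K] (n : ℕ) : Module.finrank K (QAlg K n) = 2 * n := by
  change Module.finrank K (QCoord K n) = _
  rw [Module.finrank_pi]
  simp

/-- An element of a nilpotent ideal acts nilpotently on the whole Lie algebra. -/
theorem isNilpotent_ad_of_mem_nilpotent_ideal {L : Type*} [LieRing L] [LieAlgebra K L]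
    {I : LieIdeal K L} (hI : LieRing.IsNilpotent I) {x : L} (hx : x ∈ I) :
    ∃ m, LieAlgebra.ad K L x ^ m = 0 := by
  obtain ⟨m, hm⟩ := LieModule.isNilpotent_toEnd_of_isNilpotent K I I ⟨x, hx⟩
  have hc : ∀ (j : ℕ) (y : I), (LieAlgebra.ad K L x ^ j) y =
      ((LieModule.toEnd K I I ⟨x, hx⟩ ^ j) y : I) := by
    intro j
    induction j with
    | zero => intro y; rfl
    | succ j ih =>
      intro y
      rw [pow_succ, pow_succ, Module.End.mul_apply, Module.End.mul_apply, ← ih]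
      rfl
  -- One bracket with x moves any element into I, where m further ones give zero.
  refine ⟨m + 1, LinearMap.ext fun y => ?_⟩
  have h := hc m ⟨⁅x, y⁆, lie_mem_left K L I x y hx⟩
  rw [hm] at h
  rw [pow_succ, Module.End.mul_apply]
  exact h

/-- On the span of the X_i, ad p is a derivation D with weights a 0 on X_1 and 2 * a 0 + a 1 on X_2.
If ad p is nilpotent, both vanish, and so does a. -/
theorem RAlg.le_nilIdeal (hn : 3 ≤ n) {I : LieIdeal K (RAlg K n)} (hI : LieRing.IsNilpotent I) :
    I ≤ RAlg.nilIdeal K n := by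
  intro p hp
  set x : QCoord K n := p.1
  set a : Fin 2 → K := p.2
  obtain ⟨m, hm⟩ := isNilpotent_ad_of_mem_nilpotent_ideal hI hp
  set D : QCoord K n →ₗ[K] QCoord K n := qBracketHom K n x + torusHom K n a
  have hD : IsQDerivation D := (isQDerivation_qBracketHom x).add (isQDerivation_torusHom a)
  have hdiag : diagPair D = (a 0, 2 * a 0 + a 1) := by
    have : diagPair D = diagPair (qBracketHom K n x) + diagPair (torusHom K n a) :=
      map_add (diagPairHom K n) _ _
    rw [this, diagPair_qBracketHom hn, diagPair_torusHom hn, zero_add]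
  have hpow : ∀ (j : ℕ) (y : QCoord K n),
      (LieAlgebra.ad K (RAlg K n) p ^ j) (RAlg.mk y 0) = RAlg.mk ((D ^ j) y) 0 := by
    intro j
    induction j with
    | zero => intro y; rfl
    | succ j ih =>
      intro y
      rw [pow_succ, pow_succ, Module.End.mul_apply, Module.End.mul_apply, ← ih]
      congr 1
      change ((qBracket x y + torusAct a y - torusAct 0 x, 0) : QCoord K n × (Fin 2 → K)) =
        (qBracket x y + torusAct a y, 0)
      rw [torusAct_zero_left, sub_zero]
  have hDm : D ^ m = 0 := LinearMap.ext fun y => by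
    have h := hpow m y
    rw [hm] at h
    exact (congrArg Prod.fst h).symm
  have hcoord : ∀ k, 1 ≤ k → k ≤ 2 * n → IsQDerivation.weight D k = 0 := by
    intro k hk hk'
    -- The diagonal entry of D ^ j at X_k is the j-th power of the weight, so nilpotency of D forces
    -- the weight to be zero.
    have hj : ∀ j : ℕ, (D ^ j) (qX K n k) ∈ qFlag K n k ∧
        ((D ^ j) (qX K n k)).coord k = IsQDerivation.weight D k ^ j := by
      intro j
      induction j with
      | zero =>
        refine ⟨fun l hl => ?_, ?_⟩
        · rcases lt_or_ge l 1 with h | h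
          · exact QCoord.coord_of_lt_one _ _ h
          · rw [pow_zero, Module.End.one_apply, coord_qX _ _ h (by omega), if_neg (by omega)]
        · rw [pow_zero, Module.End.one_apply, coord_qX _ _ hk hk', if_pos rfl, pow_zero]
      | succ j ih =>
        have := hD.coord_of_mem_qFlag hn ih.1
        rw [pow_succ' D, Module.End.mul_apply]
        exact ⟨this.1, by rw [this.2, ih.2, pow_succ']⟩
    have h := (hj m).2
    rw [hDm, LinearMap.zero_apply, QCoord.coord_zero] at h
    exact eq_zero_of_pow_eq_zero h.symm
  have h1 := hcoord 1 le_rfl (by omega)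
  have h2 := hcoord 2 (by omega) (by omega)
  rw [IsQDerivation.weight, hdiag, qWeight, if_pos rfl] at h1
  rw [IsQDerivation.weight, hdiag, qWeight, if_neg (by omega), if_neg (by omega)] at h2
  simp only at h1 h2
  rw [h1] at h2
  rw [RAlg.mem_nilIdeal]
  funext i
  fin_cases i
  · exact h1
  · simpa using h2

theorem RAlg.nilradicalIdeal_eq (hn : 3 ≤ n) :
    nilradicalIdeal K (RAlg K n) = RAlg.nilIdeal K n :=
  le_antisymm (sSup_le fun _ hI => RAlg.le_nilIdeal hn hI)
    (le_sSup (RAlg.isNilpotent_nilIdeal hn))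

end Standard

/-! ### Lie algebras with an ideal isomorphic to Q_{2n}: the diagonal of the adjoint action. -/

section Extension

variable {K : Type*} [Field K] {n : ℕ} {L : Type*} [LieRing L] [LieAlgebra K L]
  {N : LieIdeal K L}

/-- The adjoint action on an ideal, in coordinates of that ideal. -/
def adCoord (f : N ≃ₗ[K] QCoord K n) : L →ₗ[K] QCoord K n →ₗ[K] QCoord K n :=
  LinearMap.mk₂ K (fun x q => f ⁅x, f.symm q⁆) (fun x y q => by rw [add_lie, map_add])
    (fun t x q => by rw [smul_lie, map_smul]) (fun x p q => by rw [map_add, lie_add, map_add])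
    (fun t x q => by rw [map_smul, lie_smul, map_smul])

theorem adCoord_apply (f : N ≃ₗ[K] QCoord K n) (x : L) (q : QCoord K n) :
    adCoord f x q = f ⁅x, f.symm q⁆ := rfl

theorem symm_adCoord_apply (f : N ≃ₗ[K] QCoord K n) (x : L) (q : QCoord K n) :
    ((f.symm (adCoord f x q) : N) : L) = ⁅x, (f.symm q : L)⁆ := by
  rw [adCoord_apply, LinearEquiv.symm_apply_apply]; rfl

theorem adCoord_lie (f : N ≃ₗ[K] QCoord K n) (x y : L) :
    adCoord f ⁅x, y⁆ = adCoord f x ∘ₗ adCoord f y - adCoord f y ∘ₗ adCoord f x := by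
  refine LinearMap.ext fun q => ?_
  simp only [LinearMap.sub_apply, LinearMap.comp_apply, adCoord_apply,
    LinearEquiv.symm_apply_apply, lie_lie, map_sub]

variable {f : N ≃ₗ[K] QCoord K n} (hf : ∀ a b : N, f ⁅a, b⁆ = qBracket (f a) (f b))
include hf

theorem symm_qBracket (p q : QCoord K n) :
    ((f.symm (qBracket p q) : N) : L) = ⁅(f.symm p : L), (f.symm q : L)⁆ := by
  have h := hf (f.symm p) (f.symm q)
  rw [LinearEquiv.apply_symm_apply, LinearEquiv.apply_symm_apply] at h
  rw [← h, LinearEquiv.symm_apply_apply]; rfl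

theorem isQDerivation_adCoord (x : L) : IsQDerivation (adCoord f x) := by
  intro p q
  apply f.symm.injective
  apply Subtype.ext
  rw [symm_adCoord_apply, symm_qBracket hf, map_add, LieSubmodule.coe_add, symm_qBracket hf,
    symm_qBracket hf, symm_adCoord_apply, symm_adCoord_apply, leibniz_lie]

theorem adCoord_symm (q : QCoord K n) : adCoord f (f.symm q : L) = qBracketHom K n q := by
  refine LinearMap.ext fun p => ?_
  have h := hf (f.symm q) (f.symm p)
  rw [LinearEquiv.apply_symm_apply, LinearEquiv.apply_symm_apply] at h
  exact h

omit hf in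
/-- The diagonal entries of the adjoint action on an ideal isomorphic to `Q_{2n}`. -/
def adDiag (f : N ≃ₗ[K] QCoord K n) : L →ₗ[K] K × K := diagPairHom K n ∘ₗ adCoord f

omit hf in
theorem adDiag_apply (x : L) : adDiag f x = diagPair (adCoord f x) := rfl

theorem adDiag_lie (hn : 3 ≤ n) (x y : L) : adDiag f ⁅x, y⁆ = 0 := by
  have h : diagPair (adCoord f x ∘ₗ adCoord f y - adCoord f y ∘ₗ adCoord f x) =
      diagPair (adCoord f x ∘ₗ adCoord f y) - diagPair (adCoord f y ∘ₗ adCoord f x) :=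
    map_sub (diagPairHom K n) _ _
  have hx := isQDerivation_adCoord hf x
  have hy := isQDerivation_adCoord hf y
  rw [adDiag_apply, adCoord_lie, h, hx.diagPair_comp hn hy, hy.diagPair_comp hn hx, mul_comm,
    sub_self]

theorem adDiag_of_mem (hn : 3 ≤ n) {x : L} (hx : x ∈ N) : adDiag f x = 0 := by
  have h := adCoord_symm hf (f ⟨x, hx⟩)
  rw [LinearEquiv.symm_apply_apply] at h
  rw [adDiag_apply, h, diagPair_qBracketHom hn]

/-- The elements of `L` that act nilpotently on the ideal `N`. -/
def adDiagKer (hn : 3 ≤ n) : LieIdeal K L where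
  __ := LinearMap.ker (adDiag f)
  lie_mem {x m} _ := adDiag_lie hf hn x m

/-- An ideal that is abelian modulo `N` and acts nilpotently on `N` is nilpotent. -/
theorem isNilpotent_of_lie_le [FiniteDimensional K L] (hn : 3 ≤ n) {I : LieIdeal K L}
    (hI : I ≤ adDiagKer hf hn) (h : ⁅I, I⁆ ≤ N) : LieRing.IsNilpotent I := by
  rw [LieAlgebra.isNilpotent_iff_forall (R := K)]
  rintro ⟨x, hx⟩
  have hpow : ∀ (j : ℕ) (y : I) (hy : (y : L) ∈ N),
      (((LieAlgebra.ad K I ⟨x, hx⟩ ^ j) y : I) : L) =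
        (f.symm ((adCoord f x ^ j) (f ⟨y, hy⟩)) : N) := by
    intro j
    induction j with
    | zero => intro y hy; simp
    | succ j ih =>
      intro y hy
      have hy' : ((⁅(⟨x, hx⟩ : I), y⁆ : I) : L) ∈ N := N.lie_mem hy
      rw [pow_succ, pow_succ, Module.End.mul_apply, Module.End.mul_apply, LieAlgebra.ad_apply,
        ih _ hy', adCoord_apply, LinearEquiv.symm_apply_apply]
      rfl
  -- The first bracket lands in [I, I] ≤ N; on N the element x acts as a derivation with zero
  -- diagonal, whose power 2n vanishes.
  refine ⟨2 * n + 1, LinearMap.ext fun y => Subtype.ext ?_⟩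
  have hy' : ((⁅(⟨x, hx⟩ : I), y⁆ : I) : L) ∈ N := h (LieSubmodule.lie_mem_lie hx y.2)
  rw [pow_succ, Module.End.mul_apply, LieAlgebra.ad_apply, hpow _ _ hy',
    (isQDerivation_adCoord hf x).pow_eq_zero hn (hI hx), LinearMap.zero_apply, map_zero]
  rfl

/-- If `L` is solvable and `N` contains all nilpotent ideals, then only `N` acts nilpotently
on `N`. -/
theorem adDiagKer_eq [FiniteDimensional K L] [LieAlgebra.IsSolvable L] (hn : 3 ≤ n)
    (hmax : ∀ I : LieIdeal K L, LieRing.IsNilpotent I → I ≤ N) : adDiagKer hf hn = N := by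
  set M := adDiagKer hf hn
  have hNM : N ≤ M := fun x hx => adDiag_of_mem hf hn hx
  refine le_antisymm ?_ hNM
  obtain ⟨k, hk⟩ := LieAlgebra.IsSolvable.solvable K L
  have hk0 : LieAlgebra.derivedSeriesOfIdeal K L k M ≤ N := by
    refine (LieAlgebra.derivedSeriesOfIdeal_mono le_top k).trans ?_
    rw [← LieAlgebra.derivedSeries_def, hk]
    exact bot_le
  clear hk
  -- Descent along the derived series of M. If its term k+1 lies in N, then term k is a nilpotent
  -- ideal by `isNilpotent_of_lie_le`, so it lies in N by maximality. Term 0 is M itself.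
  induction k with
  | zero => exact hk0
  | succ k ih =>
    refine ih ?_
    set I := LieAlgebra.derivedSeriesOfIdeal K L k M
    rw [LieAlgebra.derivedSeriesOfIdeal_succ] at hk0
    exact hmax I (isNilpotent_of_lie_le hf hn (LieAlgebra.derivedSeriesOfIdeal_le_self M k) hk0)

/-- The kernel is N, of dimension 2n, so the rank is 2 = dim (K × K). -/
theorem adDiag_surjective [FiniteDimensional K L] [LieAlgebra.IsSolvable L] (hn : 3 ≤ n)
    (hmax : ∀ I : LieIdeal K L, LieRing.IsNilpotent I → I ≤ N)
    (hL : Module.finrank K L = 2 * n + 2) : Function.Surjective (adDiag f) := by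
  have hker : LinearMap.ker (adDiag f) = N.toSubmodule :=
    congrArg LieSubmodule.toSubmodule (adDiagKer_eq hf hn hmax)
  have h := LinearMap.finrank_range_add_finrank_ker (adDiag f)
  have hN : Module.finrank K N.toSubmodule = 2 * n :=
    (LinearEquiv.finrank_eq f).trans (QAlg.finrank_eq K n)
  rw [hker, hL, hN] at h
  rw [← LinearMap.range_eq_top]
  refine Submodule.eq_top_of_finrank_eq ?_
  rw [Module.finrank_prod, Module.finrank_self]
  omega

end Extension

/-! ### Eigenvector frames for generic weights and simultaneous diagonalization. -/

section Normalization

variable {K : Type*} [Field K] {n : ℕ}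

theorem linearMap_ext_qX {M : Type*} [AddCommGroup M] [Module K M] {f g : QCoord K n →ₗ[K] M}
    (h : ∀ i, 1 ≤ i → i ≤ 2 * n → f (qX K n i) = g (qX K n i)) : f = g := by
  refine LinearMap.ext fun x => ?_
  rw [eq_sum_qX x, map_sum, map_sum]
  refine Finset.sum_congr rfl fun i hi => ?_
  rw [Finset.mem_Icc] at hi
  rw [map_smul, map_smul, h i hi.1 hi.2]

/-- The iterated brackets `[X₁, [X₁, …, [X₁, X₂]]]` for arbitrary vectors in place of `X₁`, `X₂`. -/
def iterBracket (v w : QCoord K n) : ℕ → QCoord K n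
  | 0 => w
  | k + 1 => qBracket v (iterBracket v w k)

/-- The sequence obtained from two vectors in the way in which `X₁, …, X_{2n}` is obtained from
`X₁` and `X₂`. -/
def qFrame (v w : QCoord K n) (k : ℕ) : QCoord K n :=
  if k = 1 then v else if k = 2 * n then qBracket w (iterBracket v w (2 * n - 3))
  else iterBracket v w (k - 2)

theorem qFrame_one (v w : QCoord K n) : qFrame v w 1 = v := if_pos rfl

theorem qFrame_two (hn : 3 ≤ n) (v w : QCoord K n) : qFrame v w 2 = w := by
  rw [qFrame, if_neg (by omega), if_neg (by omega)]; rfl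

theorem qFrame_succ (v w : QCoord K n) (k : ℕ) (hk : 2 ≤ k) (hk' : k ≤ 2 * n - 2) :
    qFrame v w (k + 1) = qBracket v (qFrame v w k) := by
  rw [qFrame, if_neg (by omega), if_neg (by omega), qFrame, if_neg (by omega), if_neg (by omega),
    show k + 1 - 2 = (k - 2) + 1 by omega]
  rfl

theorem qFrame_last (hn : 3 ≤ n) (v w : QCoord K n) :
    qFrame v w (2 * n) = qBracket w (qFrame v w (2 * n - 1)) := by
  rw [qFrame, if_neg (by omega), if_pos rfl, qFrame, if_neg (by omega), if_neg (by omega)]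
  rfl

/-- A derivation that is diagonal on `v` and `w` is diagonal on the frame they generate. -/
theorem IsQDerivation.apply_qFrame (hn : 3 ≤ n) {D : QCoord K n →ₗ[K] QCoord K n}
    (hD : IsQDerivation D) {v w : QCoord K n} {a b : K} (hv : D v = a • v) (hw : D w = b • w)
    (k : ℕ) (hk : 1 ≤ k) (hk' : k ≤ 2 * n) :
    D (qFrame v w k) = qWeight n a b k • qFrame v w k := by
  have smul_left : ∀ (t : K) (x y : QCoord K n), qBracket (t • x) y = t • qBracket x y :=
    fun t x y => by rw [qBracket_swap, qBracket_smul_right, qBracket_swap x, smul_neg]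
  have mid : ∀ k, 2 ≤ k → k < 2 * n → D (qFrame v w k) = qWeight n a b k • qFrame v w k := by
    intro k hk
    induction k, hk using Nat.le_induction with
    | base =>
      intro _
      rw [qFrame_two hn, hw, qWeight, if_neg (by omega), if_neg (by omega)]
      simp
    | succ k hk ih =>
      intro hk'
      rw [qFrame_succ v w k hk (by omega), hD, ih (by omega), hv, smul_left, qBracket_smul_right,
        ← add_smul]
      congr 1
      simp only [qWeight]
      rw [if_neg (by omega), if_neg (by omega), if_neg (by omega), if_neg (by omega)]
      push_cast; ring
  rcases hk.eq_or_lt with rfl | h1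
  · rw [qFrame_one, hv, qWeight, if_pos rfl]
  rcases hk'.lt_or_eq with h2 | rfl
  · exact mid k h1 h2
  · rw [qFrame_last hn, hD, mid _ (by omega) (by omega), hw, smul_left, qBracket_smul_right,
      ← add_smul]
    congr 1
    rw [qWeight, if_neg (by omega), if_neg (by omega), qWeight, if_neg (by omega), if_pos rfl,
      Nat.cast_sub (by omega)]
    push_cast; ring

/-- Brackets with v shift leading terms exactly as brackets with X_1 do. Unitriangularity makes the
frame linearly independent. -/
theorem qFrame_triangular (hn : 3 ≤ n) {v w : QCoord K n} (hv : v.coord 1 = 1)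
    (hw : w ∈ qFlag K n 2) (hw' : w.coord 2 = 1) (k : ℕ) (hk : 1 ≤ k) (hk' : k ≤ 2 * n) :
    qFrame v w k ∈ qFlag K n k ∧ (qFrame v w k).coord k = 1 := by
  have mid : ∀ k, 2 ≤ k → k < 2 * n →
      qFrame v w k ∈ qFlag K n k ∧ (qFrame v w k).coord k = 1 := by
    intro k hk
    induction k, hk using Nat.le_induction with
    | base => intro _; rw [qFrame_two hn]; exact ⟨hw, hw'⟩
    | succ k hk ih =>
      intro hk'
      obtain ⟨ih1, ih2⟩ := ih (by omega)
      have key : ∀ l, 3 ≤ l → l < 2 * n →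
          (qFrame v w (k + 1)).coord l = (qFrame v w k).coord (l - 1) := by
        intro l h3 hl
        rw [qFrame_succ v w k hk (by omega), qBracket_at_mid _ _ l h3 hl, ih1 1 (by omega), hv]
        ring
      refine ⟨fun l hl => ?_, ?_⟩
      · rcases lt_or_ge l 3 with h | h
        · rw [qFrame_succ v w k hk (by omega), qBracket_at_low _ _ l h (by omega)]
        · rw [key l h (by omega), ih1 _ (by omega)]
      · rw [key _ (by omega) hk', Nat.add_sub_cancel, ih2]
  rcases hk.eq_or_lt with rfl | h1
  · rw [qFrame_one]; exact ⟨mem_qFlag_one _, hv⟩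
  rcases hk'.lt_or_eq with h2 | rfl
  · exact mid k h1 h2
  · obtain ⟨m1, m2⟩ := mid (2 * n - 1) (by omega) (by omega)
    rw [qFrame_last hn]
    refine ⟨fun l hl => ?_, ?_⟩
    · rcases lt_or_ge l 3 with h | h
      · rw [qBracket_at_low _ _ l h (by omega)]
      · rw [qBracket_at_mid _ _ l h hl, hw 1 (by omega), m1 1 (by omega)]; ring
    · rw [qBracket_at_last _ _ (by omega), Finset.sum_eq_single 2, hw',
        show 2 * n + 1 - 2 = 2 * n - 1 by omega, m2]
      · norm_num
      · intro i hi hi2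
        rw [Finset.mem_Icc] at hi
        rw [m1 _ (by omega), mul_zero, mul_zero]
      · intro h; exact absurd (Finset.mem_Icc.2 ⟨le_rfl, by omega⟩) h

/-- The linear map sending `X_k` to `z k`. -/
def qConstr (z : ℕ → QCoord K n) : QCoord K n →ₗ[K] QCoord K n :=
  ∑ i ∈ Finset.Icc 1 (2 * n), (coordForm K n i).smulRight (z i)

theorem qConstr_apply (z : ℕ → QCoord K n) (x : QCoord K n) :
    qConstr z x = ∑ i ∈ Finset.Icc 1 (2 * n), x.coord i • z i := by
  rw [qConstr, LinearMap.sum_apply]; rfl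

theorem qConstr_qX (z : ℕ → QCoord K n) (k : ℕ) (hk : 1 ≤ k) (hk' : k ≤ 2 * n) :
    qConstr z (qX K n k) = z k := by
  rw [qConstr_apply, Finset.sum_eq_single k]
  · rw [coord_qX _ _ hk hk', if_pos rfl, one_smul]
  · intro i hi hik
    rw [Finset.mem_Icc] at hi
    rw [coord_qX _ _ hi.1 hi.2, if_neg hik, zero_smul]
  · intro h; exact absurd (Finset.mem_Icc.2 ⟨hk, hk'⟩) h

theorem qConstr_injective {z : ℕ → QCoord K n}
    (hz : ∀ k, 1 ≤ k → k ≤ 2 * n → z k ∈ qFlag K n k ∧ (z k).coord k = 1) :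
    Function.Injective (qConstr z) := by
  rw [injective_iff_map_eq_zero]
  intro x hx
  have hF : ∀ k, x ∈ qFlag K n k := by
    intro k
    induction k with
    | zero => exact fun l hl => absurd hl (by omega)
    | succ k ih =>
      refine mem_qFlag_succ.2 ⟨ih, ?_⟩
      rcases lt_or_ge k 1 with h1 | h1
      · exact QCoord.coord_of_lt_one _ _ h1
      rcases lt_or_ge (2 * n) k with h2 | h2
      · exact QCoord.coord_of_gt _ _ h2
      have h := congrArg (fun y => QCoord.coord y k) hx
      simp only [qConstr_apply, coord_sum, QCoord.coord_smul, QCoord.coord_zero] at h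
      rw [Finset.sum_eq_single k, (hz k h1 h2).2, mul_one] at h
      · exact h
      · intro i hi hik
        rw [Finset.mem_Icc] at hi
        rcases lt_or_ge i k with h' | h'
        · rw [ih i h', zero_mul]
        · rw [(hz i hi.1 hi.2).1 k (by omega), mul_zero]
      · intro h'; exact absurd (Finset.mem_Icc.2 ⟨h1, h2⟩) h'
  exact eq_zero_of_mem_qFlag (Nat.lt_succ_self _) (hF _)

/-- The weights under the derivation for which `X₁` and `X₂` have weights `1` and `2n`. -/
def genericWeight (n k : ℕ) : ℕ :=
  if k = 1 then 1 else if k = 2 * n then 6 * n - 3 else 2 * n + k - 2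

theorem qWeight_generic (hn : 3 ≤ n) (k : ℕ) (hk : 1 ≤ k) :
    qWeight n (1 : K) (2 * n) k = (genericWeight n k : ℕ) := by
  unfold qWeight genericWeight
  split_ifs with h1 h2
  · simp
  · rw [Nat.cast_sub (by omega)]; push_cast; ring
  · rw [Nat.cast_sub (by omega)]; push_cast; ring

/-- Weights a on X_1 and b on X_2 are those of a Y_1 + (b - 2a) Y_2. -/
theorem qWeight_eq_weights (a b : K) (k : ℕ) :
    a * weightOne K n k + (b - 2 * a) * weightTwo K n k = qWeight n a b k := by
  unfold weightOne weightTwo qWeight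
  split_ifs with h1 h2 h2
  · omega
  · ring
  · subst h2; simp
  · ring

variable [CharZero K]

/-- Brackets in a frame of eigenvectors for generic weights. -/
theorem qBracket_qFrame_eq_zero (hn : 3 ≤ n) {H : QCoord K n →ₗ[K] QCoord K n}
    (hH : IsQDerivation H) (hd : diagPair H = (1, 2 * (n : K))) {v w : QCoord K n}
    (hv : H v = (1 : K) • v) (hw : H w = (2 * (n : K)) • w) (i j : ℕ) (hi : 1 ≤ i)
    (hi' : i ≤ 2 * n) (hj : 1 ≤ j) (hj' : j ≤ 2 * n)
    (h : ∀ k, 1 ≤ k → k ≤ 2 * n → genericWeight n k ≠ genericWeight n i + genericWeight n j) :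
    qBracket (qFrame v w i) (qFrame v w j) = 0 := by
  refine hH.eq_zero_of_apply_eq_smul hn
    (μ := ((genericWeight n i + genericWeight n j : ℕ) : K)) ?_ fun k hk hk' hkw => ?_
  · rw [hH, hH.apply_qFrame hn hv hw i hi hi', hH.apply_qFrame hn hv hw j hj hj',
      qBracket_smul_right, qBracket_swap (_ • _), qBracket_smul_right, ← smul_neg,
      ← qBracket_swap, ← add_smul, qWeight_generic hn i hi, qWeight_generic hn j hj, Nat.cast_add]
  · rw [IsQDerivation.weight, hd, qWeight_generic hn k hk] at hkw
    exact absurd (Nat.cast_injective hkw) (h k hk hk')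

/-- Only k = 2 holds by construction. The eigenvectors at k and 2n-k have weights summing to 6n-4,
which is not a weight, so they commute; applying ad v to this bracket moves the pair from k to k+1
with a change of sign. -/
theorem qBracket_qFrame_pair (hn : 3 ≤ n) {H : QCoord K n →ₗ[K] QCoord K n}
    (hH : IsQDerivation H) (hd : diagPair H = (1, 2 * (n : K))) {v w : QCoord K n}
    (hv : H v = (1 : K) • v) (hw : H w = (2 * (n : K)) • w) (k : ℕ) (hk : 2 ≤ k)
    (hk' : k ≤ 2 * n - 1) :
    qBracket (qFrame v w k) (qFrame v w (2 * n + 1 - k)) = (-1 : K) ^ k • qFrame v w (2 * n) := by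
  induction k, hk using Nat.le_induction with
  | base =>
    rw [qFrame_two hn, qFrame_last hn, show 2 * n + 1 - 2 = 2 * n - 1 by omega]; simp
  | succ k hk ih =>
    have h0 : qBracket (qFrame v w k) (qFrame v w (2 * n - k)) = 0 := by
      refine qBracket_qFrame_eq_zero hn hH hd hv hw k (2 * n - k) (by omega) (by omega) (by omega)
        (by omega) fun l hl hl' => ?_
      unfold genericWeight
      split_ifs <;> omega
    have hj := qBracket_jacobi v (qFrame v w k) (qFrame v w (2 * n - k))
    rw [h0, ← qFrame_succ v w k hk (by omega), ← qFrame_succ v w (2 * n - k) (by omega) (by omega),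
      show 2 * n - k + 1 = 2 * n + 1 - k by omega, ih (by omega)] at hj
    have hz : qBracket v (0 : QCoord K n) = 0 := by rw [qBracket_swap, qBracket_zero_left, neg_zero]
    rw [hz] at hj
    rw [show 2 * n + 1 - (k + 1) = 2 * n - k by omega, eq_neg_of_add_eq_zero_left hj.symm,
      pow_succ, mul_neg_one, neg_smul]

/-- The frame has the structure constants of Q_{2n}. Where a bracket must vanish, the sum of weights
is not a weight: 1 + (4n-3) and 1 + (6n-3) are not, (2n+i-2) + (2n+j-2) could only equal 6n-3, which
means i + j = 2n+1, and anything added to 6n-3 is too large. -/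
theorem qBracket_qFrame (hn : 3 ≤ n) {H : QCoord K n →ₗ[K] QCoord K n}
    (hH : IsQDerivation H) (hd : diagPair H = (1, 2 * (n : K))) {v w : QCoord K n}
    (hv : H v = (1 : K) • v) (hw : H w = (2 * (n : K)) • w) (i j : ℕ) (hi : 1 ≤ i)
    (hij : i < j) (hj : j ≤ 2 * n) :
    qBracket (qFrame v w i) (qFrame v w j) =
      qConstr (qFrame v w) (qBracket (qX K n i) (qX K n j)) := by
  rcases hi.eq_or_lt with rfl | hi2
  · rcases le_or_gt j (2 * n - 2) with hj2 | hj2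
    · rw [qBracket_X_one j hij hj2, qConstr_qX _ _ (by omega) (by omega), qFrame_one,
        qFrame_succ v w j hij hj2]
    · rw [qBracket_X_eq_zero 1 j le_rfl hij hj (by omega) (by omega), map_zero]
      refine qBracket_qFrame_eq_zero hn hH hd hv hw 1 j le_rfl (by omega) (by omega) hj
        fun l hl hl' => ?_
      unfold genericWeight
      split_ifs <;> omega
  · by_cases hs : i + j = 2 * n + 1
    · obtain rfl : j = 2 * n + 1 - i := by omega
      rw [qBracket_X_pair i hi2 (by omega), map_smul, qConstr_qX _ _ (by omega) (by omega),
        qBracket_qFrame_pair hn hH hd hv hw i hi2 (by omega)]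
    · rw [qBracket_X_eq_zero i j hi hij hj (by omega) (by omega), map_zero]
      refine qBracket_qFrame_eq_zero hn hH hd hv hw i j hi (by omega) (by omega) hj
        fun l hl hl' => ?_
      unfold genericWeight
      split_ifs <;> omega

/-- A derivation with generic weights is diagonalized, together with all derivations that commute
with it, by an automorphism of `Q_{2n}`. -/
theorem exists_diagonalizing_automorphism (hn : 3 ≤ n) {H : QCoord K n →ₗ[K] QCoord K n}
    (hH : IsQDerivation H) (hd : diagPair H = (1, 2 * (n : K))) :
    ∃ θ : QCoord K n →ₗ[K] QCoord K n, Function.Injective θ ∧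
      (∀ x y, θ (qBracket x y) = qBracket (θ x) (θ y)) ∧
      ∀ D : QCoord K n →ₗ[K] QCoord K n, IsQDerivation D → D ∘ₗ H = H ∘ₗ D →
        ∀ a : Fin 2 → K, diagPair D = (a 0, 2 * a 0 + a 1) →
          ∀ x, D (θ x) = θ (torusAct a x) := by
  have hw : ∀ k, 1 ≤ k → IsQDerivation.weight H k = (genericWeight n k : ℕ) := by
    intro k hk
    rw [IsQDerivation.weight, hd, qWeight_generic hn k hk]
  have hinj : ∀ k l, 1 ≤ k → k ≤ 2 * n → 1 ≤ l → l ≤ 2 * n →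
      IsQDerivation.weight H l = IsQDerivation.weight H k → l = k := by
    intro k l hk hk' hl hl' h
    rw [hw k hk, hw l hl] at h
    have h' := Nat.cast_injective h
    unfold genericWeight at h'
    split_ifs at h' <;> omega
  have hev : ∀ k, 1 ≤ k → k ≤ 2 * n → ∃ v ∈ qFlag K n k, v.coord k = 1 ∧
      H v = IsQDerivation.weight H k • v ∧ ∀ D : QCoord K n →ₗ[K] QCoord K n,
        IsQDerivation D → D ∘ₗ H = H ∘ₗ D → D v = IsQDerivation.weight D k • v := by
    intro k hk hk'
    obtain ⟨v, hv, hv1, hHv⟩ := hH.exists_eigenvector hn k hk hk' fun l hl hl' h =>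
      absurd (hinj k l hk hk' (by omega) hl' h) (by omega)
    refine ⟨v, hv, hv1, hHv, fun D hD hc => ?_⟩
    -- As D commutes with H, the vector D v - weight(k) v is again in the H-eigenspace of v. Its
    -- k-th coordinate is zero by triangularity, and no other index has the same H-weight, so it
    -- vanishes.
    rw [← sub_eq_zero]
    refine hH.eq_zero_of_apply_eq_smul hn (μ := IsQDerivation.weight H k) ?_ fun l hl hl' h => ?_
    · have := congrArg (fun F : QCoord K n →ₗ[K] QCoord K n => F v) hc
      simp only [LinearMap.comp_apply] at this
      rw [map_sub, ← this, map_smul, hHv, map_smul, smul_sub, smul_comm]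
    · rw [hinj k l hk hk' hl hl' h, QCoord.coord_sub, QCoord.coord_smul, hv1,
        (hD.coord_of_mem_qFlag hn hv).2, hv1, sub_self]
  obtain ⟨v, -, hv1, hHv, hDv⟩ := hev 1 le_rfl (by omega)
  obtain ⟨w, hwF, hw1, hHw, hDw⟩ := hev 2 (by omega) (by omega)
  have w1 : ∀ D : QCoord K n →ₗ[K] QCoord K n, IsQDerivation.weight D 1 = (diagPair D).1 :=
    fun D => if_pos rfl
  have w2 : ∀ D : QCoord K n →ₗ[K] QCoord K n, IsQDerivation.weight D 2 = (diagPair D).2 := by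
    intro D
    rw [IsQDerivation.weight, qWeight, if_neg (by omega), if_neg (by omega)]
    simp
  rw [w1, hd] at hHv
  rw [w2, hd] at hHw
  refine ⟨qConstr (qFrame v w), qConstr_injective (qFrame_triangular hn hv1 hwF hw1), ?_, ?_⟩
  · set θ := qConstr (qFrame v w)
    have hlt := qBracket_qFrame hn hH hd hHv hHw
    have hall : ∀ i j, 1 ≤ i → i ≤ 2 * n → 1 ≤ j → j ≤ 2 * n →
        θ (qBracket (qX K n i) (qX K n j)) = qBracket (θ (qX K n i)) (θ (qX K n j)) := by
      intro i j hi hi' hj hj'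
      rw [qConstr_qX _ _ hi hi', qConstr_qX _ _ hj hj']
      rcases lt_trichotomy i j with h | rfl | h
      · exact (hlt i j hi h hj').symm
      · rw [qBracket_self, qBracket_self, map_zero]
      · rw [qBracket_swap, map_neg, qBracket_swap (qFrame v w i), hlt j i hj h hi']
    have hbil : (qBracketHom K n).compr₂ θ = (qBracketHom K n).compl₁₂ θ θ :=
      linearMap_ext_qX fun i hi hi' => linearMap_ext_qX fun j hj hj' => hall i j hi hi' hj hj'
    intro x y
    exact congrArg (fun B : QCoord K n →ₗ[K] QCoord K n →ₗ[K] QCoord K n => B x y) hbil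
  · intro D hD hc a ha x
    have h1 := hDv D hD hc
    have h2 := hDw D hD hc
    rw [w1, ha] at h1
    rw [w2, ha] at h2
    have key : D ∘ₗ qConstr (qFrame v w) = qConstr (qFrame v w) ∘ₗ torusHom K n a := by
      refine linearMap_ext_qX fun i hi hi' => ?_
      have ht : torusAct a (qX K n i) = qWeight n (a 0) (2 * a 0 + a 1) i • qX K n i := by
        refine QCoord.ext_at fun k hk hk' => ?_
        rw [torusAct_at, QCoord.coord_smul, coord_qX _ _ hk hk', ← qWeight_eq_weights]
        split_ifs with h
        · rw [h]; ring
        · simp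
      rw [LinearMap.comp_apply, LinearMap.comp_apply, torusHom_apply, ht, map_smul,
        qConstr_qX _ _ hi hi', hD.apply_qFrame hn h1 h2 i hi hi']
    exact congrArg (fun F : QCoord K n →ₗ[K] QCoord K n => F x) key

end Normalization

/-! ### Reconstruction of r_{2n+2} from its nilradical. -/

section Classification

variable {K : Type*} [Field K] [CharZero K] {n : ℕ} {L : Type*} [LieRing L] [LieAlgebra K L]
  {N : LieIdeal K L}

/-- A solvable Lie algebra of dimension `2n+2` is `r_{2n+2}` if it has an ideal isomorphic to
`Q_{2n}` that contains all nilpotent ideals. -/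
theorem nonempty_lieEquiv_RAlg [LieAlgebra.IsSolvable L] (hn : 3 ≤ n)
    (hmax : ∀ I : LieIdeal K L, LieRing.IsNilpotent I → I ≤ N)
    (hL : Module.finrank K L = 2 * n + 2) (f : N ≃ₗ[K] QCoord K n)
    (hf : ∀ a b : N, f ⁅a, b⁆ = qBracket (f a) (f b)) : Nonempty (L ≃ₗ⁅K⁆ RAlg K n) := by
  -- The value of `finrank` in infinite dimension is 0, so a positive value implies finite
  -- dimension.
  have : FiniteDimensional K L := Module.finite_of_finrank_pos (by omega)
  have hsurj := adDiag_surjective hf hn hmax hL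
  obtain ⟨h, hh⟩ := hsurj (1, 2 * (n : K))
  obtain ⟨y, hy⟩ := hsurj (0, 1)
  have hH := isQDerivation_adCoord hf h
  have hN : ⁅h, y⁆ ∈ N := by
    rw [← adDiagKer_eq hf hn hmax]
    exact adDiag_lie hf hn h y
  -- The weights of h are nonzero, so ad h is onto on N. Solving [h, u] = [h, y] there makes y - u
  -- commute with h.
  obtain ⟨u, hu⟩ := hH.surjective hn (fun k hk hk' h0 => by
    rw [adDiag_apply] at hh
    rw [IsQDerivation.weight, hh, qWeight_generic hn k hk, Nat.cast_eq_zero] at h0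
    unfold genericWeight at h0
    split_ifs at h0 <;> omega) (f ⟨⁅h, y⁆, hN⟩)
  set y₂ : L := y - (f.symm u : L) with hy₂
  have hcomm : ⁅h, y₂⁆ = 0 := by
    rw [hy₂, lie_sub, ← symm_adCoord_apply, hu, LinearEquiv.symm_apply_apply, sub_self]
  have hd₂ : adDiag f y₂ = (0, 1) := by
    rw [hy₂, map_sub, hy, adDiag_of_mem hf hn (f.symm u).2, sub_zero]
  -- The coefficient turns the weights (1, 2n) of h into (1, 2), those of Y_1.
  set y₁ : L := h - (2 * (n : K) - 2) • y₂ with hy₁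
  have hcomm₁ : ⁅h, y₁⁆ = 0 := by rw [hy₁, lie_sub, lie_smul, hcomm, lie_self, smul_zero, sub_zero]
  have hcomm₁₂ : ⁅y₁, y₂⁆ = 0 := by
    rw [hy₁, sub_lie, smul_lie, hcomm, lie_self, smul_zero, sub_zero]
  have hd₁ : adDiag f y₁ = (1, 2) := by
    rw [hy₁, map_sub, map_smul, hh, hd₂]
    refine Prod.ext ?_ ?_ <;> simp
  obtain ⟨θ, hθ, hθl, hθt⟩ := exists_diagonalizing_automorphism hn hH hh
  let A : (Fin 2 → K) →ₗ[K] L :=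
    (LinearMap.proj 0).smulRight y₁ + (LinearMap.proj 1).smulRight y₂
  have hA : ∀ a, A a = a 0 • y₁ + a 1 • y₂ := fun a => rfl
  have hAd : ∀ a, adDiag f (A a) = (a 0, 2 * a 0 + a 1) := by
    intro a
    rw [hA, map_add, map_smul, map_smul, hd₁, hd₂]
    refine Prod.ext ?_ ?_ <;> simp [mul_comm]
  have hAA : ∀ a b, ⁅A a, A b⁆ = 0 := by
    intro a b
    have h21 : ⁅y₂, y₁⁆ = 0 := by rw [← lie_skew, hcomm₁₂, neg_zero]
    rw [hA, hA]
    simp [hcomm₁₂, h21]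
  -- Each A a commutes with h, so its action on N commutes with that of h and θ diagonalizes it.
  have hAt : ∀ a x, ⁅A a, (f.symm (θ x) : L)⁆ = f.symm (θ (torusAct a x)) := by
    intro a x
    have hc : ⁅A a, h⁆ = 0 := by
      rw [← lie_skew, hA, lie_add, lie_smul, lie_smul, hcomm, hcomm₁]; simp
    have hc' := adCoord_lie f (A a) h
    rw [hc, map_zero, eq_comm, sub_eq_zero] at hc'
    rw [← symm_adCoord_apply, hθt _ (isQDerivation_adCoord hf (A a)) hc' a (hAd a)]
  let φ : QCoord K n × (Fin 2 → K) →ₗ[K] L :=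
    (N.toSubmodule.subtype ∘ₗ f.symm.toLinearMap ∘ₗ θ).coprod A
  have hφ : ∀ p, φ p = (f.symm (θ p.1) : L) + A p.2 := fun p => rfl
  have hφl : ∀ p q, φ (rBracket p q) = ⁅φ p, φ q⁆ := by
    intro p q
    rw [hφ, hφ, hφ, lie_add, add_lie, add_lie, hAA, hAt, ← lie_skew _ (A q.2), hAt,
      ← symm_qBracket hf, ← hθl]
    change ((f.symm (θ (_ + _ - _)) : N) : L) + A 0 = _
    rw [map_zero]
    simp only [map_add, map_sub, LieSubmodule.coe_add, LieSubmodule.coe_sub]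
    abel
  have hφi : Function.Injective φ := by
    rw [injective_iff_map_eq_zero]
    intro p hp
    -- `adDiag` kills the N-part and so detects the torus part alone; the rest is injectivity of θ.
    have h0 := congrArg (adDiag f) hp
    rw [hφ, map_add, adDiag_of_mem hf hn (f.symm (θ p.1)).2, hAd, zero_add, map_zero,
      Prod.mk_eq_zero] at h0
    have hp2 : p.2 = 0 := by
      funext i
      fin_cases i
      · exact h0.1
      · simpa [h0.1] using h0.2
    rw [hφ, hp2, map_zero, add_zero] at hp
    have hp1 : θ p.1 = 0 := f.symm.injective (by rw [map_zero]; exact Subtype.ext hp)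
    exact Prod.ext ((injective_iff_map_eq_zero θ).1 hθ _ hp1) hp2
  let ψ : RAlg K n →ₗ⁅K⁆ L :=
    { toFun := φ
      map_add' := map_add φ
      map_smul' := map_smul φ
      map_lie' := fun {p q} => hφl p q }
  have hψs : Function.Surjective ψ :=
    (LinearMap.injective_iff_surjective_of_finrank_eq_finrank (f := ψ.toLinearMap)
      ((RAlg.finrank_eq K n).trans hL.symm)).1 hφi
  exact ⟨(LieEquiv.ofBijective ψ ⟨hφi, hψs⟩).symm⟩

end Classification

theorem proposition6 {K : Type*} [RCLike K] (n : ℕ) (hn : 3 ≤ n) :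
    (LieAlgebra.IsSolvable (RAlg K n) ∧ Module.finrank K (RAlg K n) = 2 * n + 2 ∧
      Nonempty (nilradicalIdeal K (RAlg K n) ≃ₗ⁅K⁆ QAlg K n)) ∧
    ∀ (L : Type*) [LieRing L] [LieAlgebra K L], LieAlgebra.IsSolvable L →
      Module.finrank K L = 2 * n + 2 →
      Nonempty (nilradicalIdeal K L ≃ₗ⁅K⁆ QAlg K n) →
      Nonempty (L ≃ₗ⁅K⁆ RAlg K n) := by
  refine ⟨⟨RAlg.isSolvable hn, RAlg.finrank_eq K n, ?_⟩, ?_⟩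
  · rw [RAlg.nilradicalIdeal_eq hn]
    exact ⟨RAlg.nilIdealEquiv K n⟩
  · rintro L _ _ _ hL ⟨e⟩
    -- As a supremum the nilradical contains every nilpotent ideal, which is the maximality needed.
    exact nonempty_lieEquiv_RAlg hn (fun I hI => le_sSup hI) hL e.toLinearEquiv
      fun a b => e.map_lie a b
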